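/- Let $d\ge 1$, let $\Lambda\subset\mathbb R^d$ be a lattice with covolume $V_\Lambda$, let $a_\Lambda=\min_{z\in\Lambda\setminus\{0\}}|z|$, and let $\omega_d$ be the surface area of the unit sphere in $\mathbb R^d$. Write $B_r$ for the open ball of radius $r$ around $0$ and $(a)_k=a(a+1)\cdots(a+k-1)$ for the Pochhammer symbol. *Cutoffs.* A mollifier is a rotationally invariant $\chi\in C_0^\infty(B_1)$ with $\chi\ge 0$ and $\int\chi=1$; for $\beta>0$ put $\chi_\beta=\beta^{-d}\chi(\cdot/\beta)$ and let $\hat\chi_\beta(\xi)=\int e^{-2\pi i\langle\xi,x\rangle}\chi_\beta(x)\,dx$. *Hadamard integral.* For $\nu\in\mathbb C$, a neighbourhood $\Omega$ of $0$ and $g$ smooth on $\Omega$ (and rapidly decaying if $\Omega$ is unbounded), the Hadamard finite-part integral is $$\mathrm{f.p.}\!\int_\Omega \frac{g(y)}{|y|^\nu}\,dy=\lim_{\eta\to0^+}\Big(\int_{\Omega\setminus B_\eta}\frac{g(y)}{|y|^\nu}\,dy-\sum_{0\le k\le\lfloor\mathrm{Re}\,\nu-d\rfloor}\frac1{k!}\int_{\mathbb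 R^d\setminus B_\eta}\frac{\langle y,\nabla\rangle^k g(0)}{|y|^\nu}\,dy\Big),$$ where, for $k=\mathrm{Re}\,\nu-d$, the last integral is understood as its limit as $\nu$ is approached by $\nu+\sigma$, $\sigma\to0^+$, if $\nu\ne d+k$, and is taken over $B_1\setminus B_\eta$ if $\nu=d+k$. *Operators.* For $\nu\in\mathbb C$, $\ell\in\mathbb N=\{0,1,2,\dots\}$ and $0<\varepsilon<a_\Lambda$, the local SEM operator and the HSEM operator of order $\ell$ are $$\mathcal D^{(\ell)}_{\Lambda,\nu,\varepsilon}g(x)=\sum_{k=0}^\ell\frac1{(2k)!}\lim_{\beta\to0^+}\Big(\sum_{z\in\Lambda,\,|z|>\varepsilon}-\frac1{V_\Lambda}\int_{|z|>\varepsilon}dz\Big)\,\hat\chi_\beta(z)\frac{\langle z,\nabla\rangle^{2k}g(x)}{|z|^\nu},$$ $$\mathcal D^{(\ell)}_{\Lambda,\nu}g(x)=\sum_{k=0}^\ell\frac1{(2k)!}\lim_{\beta\to0^+}\Big(\sum_{z\in\Lambda\setminus\{0\}}-\frac1{V_\Lambda}\,\mathrm{f.p.}\!\int_{\mathbb R^d}dz\Big)\,\hat\chi_\beta(z)\frac{\langle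 z,\nabla\rangle^{2k}g(x)}{|z|^\nu}.$$ **Corollary.** Let $\ell\in\mathbb N$, $\nu\in\mathbb C\setminus(d+2\mathbb N)$ and $0<\varepsilon<a_\Lambda$. Then for every $x\in\mathbb R^d$ and every complex-valued $g$ that is $C^{2\ell}$ near $x$, all the limits $\beta\to0^+$ above exist, and $$\mathcal D^{(\ell)}_{\Lambda,\nu,\varepsilon}g(x)=\mathcal D^{(\ell)}_{\Lambda,\nu}g(x)-\frac{\omega_d}{V_\Lambda}\sum_{k=0}^{\ell}\frac{(1/2)_k}{(2k)!\,(d/2)_k}\,\frac{\varepsilon^{-\nu+(2k+d)}}{\nu-(2k+d)}\,\Delta^k g(x).$$ The identity holds for arbitrary mollifiers, which may be different for the two operators. -/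

import Mathlib

open MeasureTheory Filter Topology
open scoped FourierTransform Laplacian

noncomputable section

/-- `d`-dimensional Euclidean space. -/
abbrev EucSpace (d : ℕ) : Type := EuclideanSpace ℝ (Fin d)

/-- The minimal distance `a_Λ` between distinct points of a lattice, i.e. the least norm of a
nonzero lattice vector. -/
def latticeMinDist {d : ℕ} (L : Submodule ℤ (EucSpace d)) : ℝ :=
  sInf {r : ℝ | ∃ z ∈ L, z ≠ 0 ∧ r = ‖z‖}

/-- The surface area `ω_d` of the unit sphere in `ℝ^d`. -/
def unitSphereArea (d : ℕ) : ℝ :=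
  ((volume : Measure (EucSpace d)).toSphere Set.univ).toReal

/-- `χ ∈ C₀^∞(B₁)` is nonnegative, rotationally invariant, and has integral one. -/
structure IsMollifier {d : ℕ} (χ : EucSpace d → ℝ) : Prop where
  smooth : ContDiff ℝ (⊤ : ℕ∞) χ
  hasCompactSupport : HasCompactSupport χ
  tsupport_subset : tsupport χ ⊆ Metric.ball 0 1
  rotation_invariant : ∀ (A : EucSpace d ≃ₗᵢ[ℝ] EucSpace d) (x : EucSpace d), χ (A x) = χ x
  nonneg : ∀ x, 0 ≤ χ x
  integral_eq_one : ∫ x, χ x = 1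

/-- The rescaled mollifier `χ_β = β^{-d} χ(· / β)`. -/
def scaledMollifier {d : ℕ} (χ : EucSpace d → ℝ) (β : ℝ) (x : EucSpace d) : ℝ :=
  (β ^ d)⁻¹ * χ (β⁻¹ • x)

/-- The smooth cutoff function `χ̂_β`: the Fourier transform of `χ_β`, with the convention
`v̂(ξ) = ∫ exp(-2πi⟨ξ,x⟩) v(x) dx`. -/
def smoothCutoff {d : ℕ} (χ : EucSpace d → ℝ) (β : ℝ) : EucSpace d → ℂ :=
  𝓕 (fun x : EucSpace d => (scaledMollifier χ β x : ℂ))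

/-- The directional derivative `⟨z, ∇⟩^k g(x)`. -/
def dirDeriv {d : ℕ} (k : ℕ) (z : EucSpace d) (g : EucSpace d → ℂ) (x : EucSpace d) : ℂ :=
  iteratedFDeriv ℝ k g x (fun _ => z)

/-- The sum-integral of `f` over `(Ω, Λ)`:
`∑_{y ∈ Ω ∩ Λ} f(y) - V_Λ⁻¹ ∫_Ω f(y) dy`. -/
def sumIntegral {d : ℕ} (L : Submodule ℤ (EucSpace d)) (Ω : Set (EucSpace d))
    (f : EucSpace d → ℂ) : ℂ :=
  (∑' y : (Ω ∩ (L : Set (EucSpace d)) : Set (EucSpace d)), f y)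
    - (1 / (ZLattice.covolume L : ℂ)) * ∫ y in Ω, f y

/-- The moment `∫_{ℝ^d ∖ B_ε} ⟨y,∇⟩^k g(0) |y|^{-ν} dy` that occurs in the Hadamard regularisation,
for `k ≤ Re ν - d`.

* For `k < Re ν - d` the integral converges absolutely, and the limit below is its value.
* For `k = Re ν - d` with `ν ≠ d + k` it does not converge, and it is understood as the limit of
  the convergent integrals with exponent `ν + σ` as `σ → 0⁺` (this is the value for which the
  Hadamard integral is the homogeneous extension of `|·|^{-ν}`).
* For `ν = d + k` the domain of integration is replaced by `B_1 ∖ B_ε`. -/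
def hadamardMoment {d : ℕ} (ν : ℂ) (ε : ℝ) (k : ℕ) (g : EucSpace d → ℂ) : ℂ :=
  open Classical in
  if ν = (d : ℂ) + k then
    ∫ y in Metric.ball 0 1 \ Metric.ball 0 ε, dirDeriv k y g 0 / (‖y‖ : ℂ) ^ ν
  else
    limUnder (𝓝[>] (0 : ℝ)) fun σ : ℝ =>
      ∫ y in (Metric.ball 0 ε)ᶜ, dirDeriv k y g 0 / (‖y‖ : ℂ) ^ (ν + σ)

/-- The Hadamard regularisation `(ℋ_{ν,ε} g)(0)`: the sum over `0 ≤ k ≤ ⌊Re ν - d⌋` of `1/k!` times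
the `k`-th moment. The sum is empty if `⌊Re ν - d⌋ < 0`. -/
def hadamardRegularisation {d : ℕ} (ν : ℂ) (ε : ℝ) (g : EucSpace d → ℂ) : ℂ :=
  ∑ k ∈ Finset.range (⌊ν.re - d⌋ + 1).toNat, (1 / (k.factorial : ℂ)) * hadamardMoment ν ε k g

/-- The Hadamard finite-part integral of `g(y) / |y|^ν` over a neighbourhood `Ω` of the origin. -/
def hadamardIntegral {d : ℕ} (Ω : Set (EucSpace d)) (ν : ℂ) (g : EucSpace d → ℂ) : ℂ :=
  limUnder (𝓝[>] (0 : ℝ)) fun ε : ℝ =>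
    (∫ y in Ω \ Metric.ball 0 ε, g y / (‖y‖ : ℂ) ^ ν) - hadamardRegularisation ν ε g

/-- The Hadamard sum-integral of `g(y) / |y|^ν` over `(Ω, Λ)`; the sum excludes the origin. -/
def hadamardSumIntegral {d : ℕ} (L : Submodule ℤ (EucSpace d)) (Ω : Set (EucSpace d)) (ν : ℂ)
    (g : EucSpace d → ℂ) : ℂ :=
  (∑' y : ((Ω ∩ (L : Set (EucSpace d))) \ {0} : Set (EucSpace d)),
      g y / (‖(y : EucSpace d)‖ : ℂ) ^ ν)
    - (1 / (ZLattice.covolume L : ℂ)) * hadamardIntegral Ω ν g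

/-- The regularised `k`-th coefficient of the local SEM operator, applied to `g` at `x`: the
sum-integral over `ℝ^d ∖ B̄_ε` of `χ̂_β(z) ⟨z,∇⟩^{2k} g(x) / |z|^ν`. -/
def localSEMCoeff {d : ℕ} (L : Submodule ℤ (EucSpace d)) (χ : EucSpace d → ℝ) (ν : ℂ) (ε : ℝ)
    (k : ℕ) (g : EucSpace d → ℂ) (x : EucSpace d) (β : ℝ) : ℂ :=
  sumIntegral L (Metric.closedBall 0 ε)ᶜ
    fun z => smoothCutoff χ β z * (dirDeriv (2 * k) z g x / (‖z‖ : ℂ) ^ ν)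

/-- The regularised `k`-th coefficient of the HSEM operator, applied to `g` at `x`: the Hadamard
sum-integral over `ℝ^d` of `χ̂_β(z) ⟨z,∇⟩^{2k} g(x) / |z|^ν`. -/
def hsemCoeff {d : ℕ} (L : Submodule ℤ (EucSpace d)) (χ : EucSpace d → ℝ) (ν : ℂ)
    (k : ℕ) (g : EucSpace d → ℂ) (x : EucSpace d) (β : ℝ) : ℂ :=
  hadamardSumIntegral L Set.univ ν fun z => smoothCutoff χ β z * dirDeriv (2 * k) z g x

/-- The local SEM operator of order `ℓ`, applied to `g` at `x`. -/
def localSEMOperator {d : ℕ} (L : Submodule ℤ (EucSpace d)) (χ : EucSpace d → ℝ) (ν : ℂ) (ε : ℝ)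
    (ℓ : ℕ) (g : EucSpace d → ℂ) (x : EucSpace d) : ℂ :=
  ∑ k ∈ Finset.range (ℓ + 1), (1 / ((2 * k).factorial : ℂ)) *
    limUnder (𝓝[>] (0 : ℝ)) (localSEMCoeff L χ ν ε k g x)

/-- The hypersingular Euler-Maclaurin (HSEM) operator of order `ℓ`, applied to `g` at `x`. -/
def hsemOperator {d : ℕ} (L : Submodule ℤ (EucSpace d)) (χ : EucSpace d → ℝ) (ν : ℂ)
    (ℓ : ℕ) (g : EucSpace d → ℂ) (x : EucSpace d) : ℂ :=
  ∑ k ∈ Finset.range (ℓ + 1), (1 / ((2 * k).factorial : ℂ)) *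
    limUnder (𝓝[>] (0 : ℝ)) (hsemCoeff L χ ν k g x)

/-- The Pochhammer symbol `(a)_k = a (a+1) ⋯ (a+k-1)`. -/
def pochhammer (a : ℂ) (k : ℕ) : ℂ := (ascPochhammer ℂ k).eval a

/-- The `k`-th power of the Laplacian of `g` at `x`. -/
def polyLaplacian {d : ℕ} (k : ℕ) (g : EucSpace d → ℂ) (x : EucSpace d) : ℂ :=
  (fun h : EucSpace d → ℂ => Δ h)^[k] g x

end

/-!
The local operator and the HSEM operator contain, for `ε < a_Λ`, the same lattice sum, so their
coefficients differ only by `V_Λ⁻¹` times the finite part of the integral over the ball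
`|y| ≤ ε`. Two facts have to be established: the coefficients of the local operator converge to a
limit that does not depend on the mollifier, and the finite part over the ball converges, as the
cutoff is removed, to an explicit multiple of the iterated Laplacian.

*Convergence.* Let `A` be the average over translates by a fundamental cell. Summing `A G` over `Λ`
gives `V_Λ⁻¹ ∫ G`, and `A` preserves integrals, so the defect `∑_Λ G - V_Λ⁻¹ ∫ G` is unchanged when
`G` is replaced by `(I - A)^N G` (`HasPolyGrowth.latticeDefect_iterate_avgDiff`). The function
`(I - A)^N G` is an average of `N`-th order differences, hence is controlled by the `N`-th
derivative of `G` (`HasPolyGrowth.norm_iterate_avgDiff_le`). The summand is a cutoff `w(β z)`, with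
`w` a Schwartz function, times a kernel that is smooth and homogeneous off the origin; each
derivative gains a factor `|z|⁻¹` uniformly in `β`. For large `N` dominated convergence applies to
the sum and to the integral separately, and the limit only involves the kernel and `w 0 = 1`
(`exists_latticeDefect_limit`, `exists_localSEMCoeff_limit`). No Poisson summation is needed.

*Finite part.* In polar coordinates the Hadamard moments are explicit powers of the radius times
integrals of Taylor forms over the unit sphere (`exteriorMoment`, `hadamardMoment_eq`), the odd ones
vanishing. Subtracting the moments turns the Hadamard integral into absolutely convergent integrals
and moments at radius `ε` (`hadamardIntegral_eq`). For the function `w(β y) P(y)`, with `P`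
homogeneous of degree `2k`, the Taylor forms of degree below `2k` vanish and those of degree above
`2k` carry a positive power of `β`, so only `P` itself contributes in the limit
(`tendsto_hadamardIntegral_sub`).

*Spherical mean.* Integrating by parts against `exp(-|y|²)` lowers the degree of the Taylor form of
`g` by two and produces a Laplacian. Comparing with the integral in polar coordinates identifies the
integral of `⟨y, ∇⟩^{2k} g(x)` over the sphere as `ω_d (1/2)_k / (d/2)_k Δ^k g(x)`
(`sphereIntegral_iteratedFDeriv`).
-/

/-! ### Functions of polynomial growth and the averaged difference operator -/

/-- `G` is measurable and bounded by `C (1 + |x|)^s`. -/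
structure HasPolyGrowth {d : ℕ} (s C : ℝ) (G : EucSpace d → ℂ) : Prop where
  measurable : Measurable G
  norm_le : ∀ x, ‖G x‖ ≤ C * (1 + ‖x‖) ^ s

/-- The averaged difference `(I - A) G`, where `A G(x) = ∫ G(x + q) dμ(q)` is the average of the
translates of `G` with respect to a probability measure `μ`. -/
noncomputable def avgDiff {d : ℕ} (μ : Measure (EucSpace d)) (G : EucSpace d → ℂ) :
    EucSpace d → ℂ :=
  fun x => ∫ q, (G x - G (x + q)) ∂μ

/-- The constant by which an averaged difference over a ball of radius `R` increases the
constant in a bound of growth exponent `s`. -/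
noncomputable def growthFactor (R s : ℝ) : ℝ := 1 + (1 + R) ^ |s|

lemma growthFactor_nonneg {R s : ℝ} (hR : 0 ≤ R) : 0 ≤ growthFactor R s := by
  unfold growthFactor; positivity

lemma one_add_norm_rpow_add_le {E : Type*} [SeminormedAddCommGroup E] {R : ℝ} (s : ℝ) (x q : E)
    (hq : ‖q‖ ≤ R) : (1 + ‖x + q‖) ^ s ≤ (1 + R) ^ |s| * (1 + ‖x‖) ^ s := by
  have hR : 0 ≤ R := (norm_nonneg q).trans hq
  have hx := norm_nonneg x
  have hxq := norm_nonneg (x + q)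
  have h1 : 1 + ‖x + q‖ ≤ (1 + R) * (1 + ‖x‖) := by
    have := norm_add_le x q
    nlinarith [mul_nonneg hR hx]
  have h2 : 1 + ‖x‖ ≤ (1 + R) * (1 + ‖x + q‖) := by
    have : ‖x‖ ≤ ‖x + q‖ + ‖q‖ := by simpa using norm_sub_le (x + q) q
    nlinarith [mul_nonneg hR hxq]
  rcases le_total 0 s with hs | hs
  · rw [abs_of_nonneg hs, ← Real.mul_rpow (by positivity) (by positivity)]
    exact Real.rpow_le_rpow (by positivity) h1 hs
  · rw [abs_of_nonpos hs]
    have h3 : ((1 + R) * (1 + ‖x + q‖)) ^ s ≤ (1 + ‖x‖) ^ s :=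
      Real.rpow_le_rpow_of_nonpos (by positivity) h2 hs
    calc (1 + ‖x + q‖) ^ s = (1 + R) ^ (-s) * ((1 + R) * (1 + ‖x + q‖)) ^ s := by
          rw [Real.mul_rpow (by positivity) (by positivity), ← mul_assoc,
            ← Real.rpow_add (by positivity)]
          simp
      _ ≤ _ := by gcongr

section AvgDiff

variable {d : ℕ} {μ : Measure (EucSpace d)} {R s C : ℝ} {G : EucSpace d → ℂ}

lemma HasPolyGrowth.const_nonneg (h : HasPolyGrowth s C G) : 0 ≤ C := by
  have := (norm_nonneg _).trans (h.norm_le 0)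
  simpa using this

lemma HasPolyGrowth.translate_norm_le (h : HasPolyGrowth s C G) (x : EucSpace d)
    {q : EucSpace d} (hq : ‖q‖ ≤ R) :
    ‖G (x + q)‖ ≤ (1 + R) ^ |s| * C * (1 + ‖x‖) ^ s := by
  have := h.const_nonneg
  calc ‖G (x + q)‖ ≤ C * (1 + ‖x + q‖) ^ s := h.norm_le _
    _ ≤ C * ((1 + R) ^ |s| * (1 + ‖x‖) ^ s) := by
      gcongr; exact one_add_norm_rpow_add_le s x q hq
    _ = _ := by ring

lemma HasPolyGrowth.sub_translate (h : HasPolyGrowth s C G)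
    {q : EucSpace d} (hq : ‖q‖ ≤ R) :
    HasPolyGrowth s (growthFactor R s * C) (fun x => G x - G (x + q)) where
  measurable := h.measurable.sub (h.measurable.comp (measurable_id.add_const q))
  norm_le x := by
    have h1 := h.norm_le x
    have h2 := h.translate_norm_le x hq
    have h3 := norm_sub_le (G x) (G (x + q))
    unfold growthFactor
    linarith

variable [IsProbabilityMeasure μ]

lemma HasPolyGrowth.integrable_translate (h : HasPolyGrowth s C G)
    (hμ : ∀ᵐ q ∂μ, ‖q‖ ≤ R) (x : EucSpace d) : Integrable (fun q => G (x + q)) μ := by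
  refine Integrable.of_bound
    (h.measurable.comp (measurable_id.const_add x)).aestronglyMeasurable
    ((1 + R) ^ |s| * C * (1 + ‖x‖) ^ s) ?_
  filter_upwards [hμ] with q hq
  exact h.translate_norm_le x hq

lemma HasPolyGrowth.avgDiff_apply (h : HasPolyGrowth s C G)
    (hμ : ∀ᵐ q ∂μ, ‖q‖ ≤ R) (x : EucSpace d) :
    avgDiff μ G x = G x - ∫ q, G (x + q) ∂μ := by
  unfold avgDiff
  rw [integral_sub (integrable_const _) (h.integrable_translate hμ x)]
  simp

lemma HasPolyGrowth.avgDiff (h : HasPolyGrowth s C G) (hμ : ∀ᵐ q ∂μ, ‖q‖ ≤ R) :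
    HasPolyGrowth s (growthFactor R s * C) (avgDiff μ G) where
  measurable := by
    have : Measurable (Function.uncurry fun x q : EucSpace d => G x - G (x + q)) :=
      (h.measurable.comp measurable_fst).sub
        (h.measurable.comp (measurable_fst.add measurable_snd))
    exact (this.stronglyMeasurable.integral_prod_right (ν := μ)).measurable
  norm_le x := by
    have := norm_integral_le_of_norm_le_const (μ := μ) (f := fun q => G x - G (x + q))
      (C := growthFactor R s * C * (1 + ‖x‖) ^ s)
      (by filter_upwards [hμ] with q hq using (h.sub_translate hq).norm_le x)
    simpa [_root_.avgDiff] using this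

lemma HasPolyGrowth.iterate_avgDiff (h : HasPolyGrowth s C G) (hμ : ∀ᵐ q ∂μ, ‖q‖ ≤ R) (N : ℕ) :
    HasPolyGrowth s (growthFactor R s ^ N * C) ((_root_.avgDiff μ)^[N] G) := by
  induction N with
  | zero => simpa using h
  | succ N ih =>
    rw [Function.iterate_succ_apply', pow_succ', mul_assoc]
    exact ih.avgDiff hμ

lemma HasPolyGrowth.iterate_avgDiff_sub_translate (h : HasPolyGrowth s C G)
    (hμ : ∀ᵐ q ∂μ, ‖q‖ ≤ R) (q : EucSpace d) (N : ℕ) :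
    (_root_.avgDiff μ)^[N] (fun x => G x - G (x + q))
      = fun x => (_root_.avgDiff μ)^[N] G x - (_root_.avgDiff μ)^[N] G (x + q) := by
  induction N with
  | zero => rfl
  | succ N ih =>
    have hN := h.iterate_avgDiff hμ N
    rw [Function.iterate_succ_apply', Function.iterate_succ_apply', ih]
    funext x
    have hint : ∀ y, Integrable (fun p => (_root_.avgDiff μ)^[N] G y
        - (_root_.avgDiff μ)^[N] G (y + p)) μ := fun y =>
      (integrable_const _).sub (hN.integrable_translate hμ y)
    unfold _root_.avgDiff at hint ⊢
    rw [← integral_sub (hint x) (hint (x + q))]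
    congr 1 with p
    beta_reduce
    rw [add_right_comm x p q]
    ring

/-- The `N`-fold averaged difference is controlled by the `N`-th derivative on a ball of radius
`N R`: it averages `N`-th order differences with increments of norm at most `R`. -/
lemma HasPolyGrowth.norm_iterate_avgDiff_le (hR : 0 ≤ R) (hμ : ∀ᵐ q ∂μ, ‖q‖ ≤ R) (N : ℕ) :
    ∀ {C : ℝ} {G : EucSpace d → ℂ} {M : ℝ} {x : EucSpace d}, HasPolyGrowth s C G →
    (∀ y ∈ Metric.closedBall x (N * R), ContDiffAt ℝ N G y ∧ ‖iteratedFDeriv ℝ N G y‖ ≤ M) →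
    ‖(_root_.avgDiff μ)^[N] G x‖ ≤ R ^ N * M := by
  induction N with
  | zero =>
    intro C G M x h hG
    simpa using (hG x (by simp)).2
  | succ N ih =>
    intro C G M x h hG
    rw [Function.iterate_succ_apply']
    have := norm_integral_le_of_norm_le_const (μ := μ)
      (f := fun q => (_root_.avgDiff μ)^[N] G x - (_root_.avgDiff μ)^[N] G (x + q))
      (C := R ^ N * (M * R)) ?_
    · rw [pow_succ, mul_assoc, mul_comm R M]
      simpa [_root_.avgDiff] using this
    · filter_upwards [hμ] with q hq
      rw [← congrFun (h.iterate_avgDiff_sub_translate hμ q N) x]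
      refine ih (h.sub_translate hq) fun y hy => ?_
      rw [mem_closedBall_iff_norm] at hy
      have hy1 : y ∈ Metric.closedBall x ((N + 1 : ℕ) * R) := by
        rw [mem_closedBall_iff_norm]; push_cast; linarith
      have hy2 : y + q ∈ Metric.closedBall x ((N + 1 : ℕ) * R) := by
        rw [mem_closedBall_iff_norm, add_sub_right_comm]
        push_cast
        linarith [norm_add_le (y - x) q]
      have hle : ((N : ℕ) : WithTop ℕ∞) ≤ ((N + 1 : ℕ) : WithTop ℕ∞) := by
        exact_mod_cast Nat.le_succ N
      have hlt : ((N : ℕ) : WithTop ℕ∞) < ((N + 1 : ℕ) : WithTop ℕ∞) := by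
        exact_mod_cast Nat.lt_succ_self N
      have hc1 := (hG y hy1).1.of_le hle
      have hc2 : ContDiffAt ℝ N (fun z => G (z + q)) y :=
        ((hG _ hy2).1.of_le hle).comp y (contDiffAt_id.add contDiffAt_const)
      refine ⟨hc1.sub hc2, ?_⟩
      have he : iteratedFDeriv ℝ N (fun z => G z - G (z + q)) y
          = iteratedFDeriv ℝ N G y - iteratedFDeriv ℝ N G (y + q) := by
        rw [← iteratedFDeriv_comp_add_right N q y]
        exact iteratedFDeriv_sub_apply hc1 hc2
      rw [he]
      have hmv := Convex.norm_image_sub_le_of_norm_fderiv_le (𝕜 := ℝ)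
        (f := iteratedFDeriv ℝ N G) (C := M)
        (fun z hz => (hG z hz).1.differentiableAt_iteratedFDeriv hlt)
        (fun z hz => by rw [norm_fderiv_iteratedFDeriv]; exact (hG z hz).2)
        (convex_closedBall x ((N + 1 : ℕ) * R)) hy2 hy1
      have hM : 0 ≤ M := (norm_nonneg _).trans (hG y hy1).2
      calc _ ≤ M * ‖y - (y + q)‖ := hmv
        _ ≤ M * R := by gcongr; simpa using hq

lemma tendsto_iterate_avgDiff (hμ : ∀ᵐ q ∂μ, ‖q‖ ≤ R) {ι : Type*} {l : Filter ι}
    [l.IsCountablyGenerated] {G : ι → EucSpace d → ℂ} {G₀ : EucSpace d → ℂ}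
    (hG : ∀ᶠ b in l, HasPolyGrowth s C (G b))
    (hlim : ∀ x, Tendsto (fun b => G b x) l (𝓝 (G₀ x))) (N : ℕ) (x : EucSpace d) :
    Tendsto (fun b => (avgDiff μ)^[N] (G b) x) l (𝓝 ((avgDiff μ)^[N] G₀ x)) := by
  induction N generalizing x with
  | zero => exact hlim x
  | succ N ih =>
    simp only [Function.iterate_succ_apply']
    refine tendsto_integral_filter_of_dominated_convergence
      (fun _ => growthFactor R s * (growthFactor R s ^ N * C) * (1 + ‖x‖) ^ s) ?_ ?_
      (integrable_const _) (.of_forall fun q => (ih x).sub (ih (x + q)))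
    · filter_upwards [hG] with b hb
      exact ((integrable_const _).sub
        ((hb.iterate_avgDiff hμ N).integrable_translate hμ x)).aestronglyMeasurable
    · filter_upwards [hG] with b hb
      filter_upwards [hμ] with q hq
      exact ((hb.iterate_avgDiff hμ N).sub_translate hq).norm_le x

end AvgDiff

/-! ### Lattice sums minus integrals -/

lemma HasPolyGrowth.integrable {d : ℕ} {s C : ℝ} {G : EucSpace d → ℂ}
    (h : HasPolyGrowth s C G) (hs : s < -d) : Integrable G := by
  have h1 := integrable_one_add_norm (E := EucSpace d) (μ := volume) (r := -s)
    (by simp; linarith)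
  rw [neg_neg] at h1
  exact (h1.const_mul C).mono' h.measurable.aestronglyMeasurable (.of_forall h.norm_le)

section LatticeDefect

variable {d : ℕ} (L : Submodule ℤ (EucSpace d))

/-- The difference `∑_{z ∈ Λ} G(z) - V_Λ⁻¹ ∫ G` between a lattice sum and the integral. -/
noncomputable def latticeDefect (G : EucSpace d → ℂ) : ℂ :=
  (∑' z : L, G z) - (1 / (ZLattice.covolume L : ℂ)) * ∫ y, G y

variable [DiscreteTopology L] [IsZLattice ℝ L]

/-- The normalised Lebesgue measure on a fundamental cell: a compactly supported probability
measure whose translates by `Λ` add up to the multiple `V_Λ⁻¹` of Lebesgue measure. -/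
lemma exists_fundamentalCell_average : ∃ (μ : Measure (EucSpace d)) (R : ℝ),
    IsProbabilityMeasure μ ∧ 0 ≤ R ∧ (∀ᵐ q ∂μ, ‖q‖ ≤ R) ∧
    ∀ G : EucSpace d → ℂ, Integrable G →
      ∑' z : L, ∫ q, G (z + q) ∂μ = (1 / (ZLattice.covolume L : ℂ)) * ∫ y, G y := by
  have : Module.Free ℤ L := ZLattice.module_free ℝ L
  have : Module.Finite ℤ L := ZLattice.module_finite ℝ L
  have hfd := ZLattice.isAddFundamentalDomain (L := L) (Module.Free.chooseBasis ℤ L)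
    (volume : Measure (EucSpace d))
  have hb := ZSpan.fundamentalDomain_isBounded
    ((Module.Free.chooseBasis ℤ L).ofZLatticeBasis ℝ L)
  have hm := ZSpan.fundamentalDomain_measurableSet
    ((Module.Free.chooseBasis ℤ L).ofZLatticeBasis ℝ L)
  set Q := ZSpan.fundamentalDomain ((Module.Free.chooseBasis ℤ L).ofZLatticeBasis ℝ L)
  have hV := ZLattice.covolume_eq_measure_fundamentalDomain L volume hfd
  have hVpos := ZLattice.covolume_pos L (volume : Measure (EucSpace d))
  have hQtop : volume Q ≠ ⊤ := hb.measure_lt_top.ne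
  have hQ0 : volume Q ≠ 0 := by
    intro h
    rw [hV, Measure.real, h] at hVpos
    simp at hVpos
  obtain ⟨R, hR⟩ := hb.exists_norm_le
  refine ⟨(volume Q)⁻¹ • volume.restrict Q, max R 0, ⟨?_⟩, le_max_right _ _, ?_, fun G hG => ?_⟩
  · simp [ENNReal.inv_mul_cancel hQ0 hQtop]
  · refine Measure.ae_smul_measure ?_ _
    filter_upwards [ae_restrict_mem hm] with q hq using (hR q hq).trans (le_max_left _ _)
  · have : VAddInvariantMeasure L (EucSpace d) volume :=
      inferInstanceAs (VAddInvariantMeasure L.toAddSubgroup (EucSpace d) volume)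
    rw [hfd.integral_eq_tsum'' G hG, ← tsum_mul_left]
    congr 1 with z
    rw [integral_smul_measure, ENNReal.toReal_inv, hV, Complex.real_smul]
    simp [Measure.real, Submodule.vadd_def]

lemma summable_lattice_one_add_norm_rpow {s : ℝ} (hs : s < -d) :
    Summable fun z : L => (1 + ‖(z : EucSpace d)‖) ^ s := by
  have hrank : Module.finrank ℤ L = d := by
    rw [ZLattice.rank ℝ L]; simp
  have := ZLattice.summable_norm_rpow L s (by rw [hrank]; exact hs)
  refine this.of_norm_bounded_eventually ?_
  filter_upwards [(Set.finite_singleton (0 : L)).compl_mem_cofinite] with z hz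
  have hz' : 0 < ‖z‖ := norm_pos_iff.2 hz
  have hd : (0 : ℝ) ≤ d := Nat.cast_nonneg d
  rw [Real.norm_of_nonneg (by positivity)]
  exact Real.rpow_le_rpow_of_nonpos hz' (by simp) (by linarith)

variable {L} {s C R : ℝ} {G : EucSpace d → ℂ}

lemma HasPolyGrowth.summable_lattice (h : HasPolyGrowth s C G) (hs : s < -d) :
    Summable fun z : L => G z :=
  ((summable_lattice_one_add_norm_rpow L hs).mul_left C).of_norm_bounded fun z => h.norm_le z

variable {μ : Measure (EucSpace d)} [IsProbabilityMeasure μ]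

/-- Averaging over a fundamental cell turns the lattice sum into the integral and preserves the
integral, so the averaged difference has the same defect. -/
lemma HasPolyGrowth.latticeDefect_avgDiff (h : HasPolyGrowth s C G) (hs : s < -d)
    (hμ : ∀ᵐ q ∂μ, ‖q‖ ≤ R)
    (hcell : ∀ G : EucSpace d → ℂ, Integrable G →
      ∑' z : L, ∫ q, G (z + q) ∂μ = (1 / (ZLattice.covolume L : ℂ)) * ∫ y, G y) :
    latticeDefect L (_root_.avgDiff μ G) = latticeDefect L G := by
  have hG := h.integrable hs
  have hfun : _root_.avgDiff μ G = fun x => G x - ∫ q, G (x + q) ∂μ :=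
    funext fun x => h.avgDiff_apply hμ x
  have hA : HasPolyGrowth s ((1 + growthFactor R s) * C) fun x => ∫ q, G (x + q) ∂μ := by
    have h' := h.avgDiff hμ
    have he : (fun x => ∫ q, G (x + q) ∂μ) = fun x => G x - _root_.avgDiff μ G x := by
      rw [hfun]; funext x; simp
    rw [he]
    refine ⟨h.measurable.sub h'.measurable, fun x => ?_⟩
    have := norm_sub_le (G x) (_root_.avgDiff μ G x)
    linarith [h.norm_le x, h'.norm_le x]
  have hint : ∫ x, ∫ q, G (x + q) ∂μ = ∫ x, G x := by
    rw [integral_integral_swap]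
    · simp [integral_add_right_eq_self]
    · have h1 : Integrable (fun p : EucSpace d × EucSpace d => G p.1) (volume.prod μ) :=
        hG.comp_fst μ
      have h2 : MeasurePreserving (fun p : EucSpace d × EucSpace d => (p.1 + p.2, p.2))
          (volume.prod μ) (volume.prod μ) := measurePreserving_add_prod volume μ
      exact h2.integrable_comp_of_integrable h1
  unfold latticeDefect
  rw [hfun, integral_sub hG (hA.integrable hs), hint,
    (h.summable_lattice hs).tsum_sub (hA.summable_lattice hs), hcell G hG]
  ring

lemma HasPolyGrowth.latticeDefect_iterate_avgDiff (h : HasPolyGrowth s C G) (hs : s < -d)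
    (hμ : ∀ᵐ q ∂μ, ‖q‖ ≤ R)
    (hcell : ∀ G : EucSpace d → ℂ, Integrable G →
      ∑' z : L, ∫ q, G (z + q) ∂μ = (1 / (ZLattice.covolume L : ℂ)) * ∫ y, G y) (N : ℕ) :
    latticeDefect L ((_root_.avgDiff μ)^[N] G) = latticeDefect L G := by
  induction N with
  | zero => rfl
  | succ N ih =>
    rw [Function.iterate_succ_apply',
      (h.iterate_avgDiff hμ N).latticeDefect_avgDiff hs hμ hcell, ih]

/-- A uniform symbol bound `|D^N G| ≤ K |y|^(-d-1)` away from the origin, together with a uniform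
growth bound, makes the `N`-fold averaged difference decay like `(1 + |x|)^(-d-1)`. -/
lemma exists_norm_iterate_avgDiff_le (hR : 0 ≤ R) (hμ : ∀ᵐ q ∂μ, ‖q‖ ≤ R) (N : ℕ)
    (s C K ρ : ℝ) (hC : 0 ≤ C) (hK : 0 ≤ K) (hρ : 0 ≤ ρ) :
    ∃ B : ℝ, ∀ G : EucSpace d → ℂ, HasPolyGrowth s C G →
      (∀ y, ρ < ‖y‖ → ContDiffAt ℝ N G y ∧
        ‖iteratedFDeriv ℝ N G y‖ ≤ K * ‖y‖ ^ (-(d + 1 : ℝ))) →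
      ∀ x, ‖(_root_.avgDiff μ)^[N] G x‖ ≤ B * (1 + ‖x‖) ^ (-(d + 1 : ℝ)) := by
  set e : ℝ := -(d + 1 : ℝ) with he
  have he0 : e ≤ 0 := by rw [he]; have : (0 : ℝ) ≤ d := Nat.cast_nonneg d; linarith
  set T : ℝ := 2 * (N * R) + ρ + 2 with hT
  have hNR : 0 ≤ N * R := by positivity
  have hT0 : 0 < T := by positivity
  set B1 := R ^ N * (K * (1 / 4) ^ e)
  set B2 := growthFactor R s ^ N * C * (1 + T) ^ |s| * (1 + T) ^ (-e)
  have hgf := growthFactor_nonneg (s := s) hR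
  have hB1 : 0 ≤ B1 := by positivity
  have hB2 : 0 ≤ B2 := by positivity
  refine ⟨B1 + B2, fun G hG hD x => ?_⟩
  have hx0 := norm_nonneg x
  -- For `|x| ≥ T` the ball of radius `N R` around `x` stays in the region `|y| > ρ`, and `|y|` is
  -- comparable to `|x|` on it; for `|x| ≤ T` the growth bound is enough.
  rcases le_total T ‖x‖ with hx | hx
  · have hy : ∀ y ∈ Metric.closedBall x (N * R), ρ < ‖y‖ ∧ (1 / 4) * (1 + ‖x‖) ≤ ‖y‖ := by
      intro y hy
      rw [mem_closedBall_iff_norm'] at hy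
      have : ‖x‖ - ‖y‖ ≤ ‖x - y‖ := norm_sub_norm_le x y
      constructor <;> linarith
    have hbd := hG.norm_iterate_avgDiff_le hR hμ N (M := K * (1 / 4) ^ e * (1 + ‖x‖) ^ e)
      (x := x) fun y hyx => by
        obtain ⟨h1, h2⟩ := hy y hyx
        refine ⟨(hD y h1).1, (hD y h1).2.trans ?_⟩
        rw [mul_assoc, ← Real.mul_rpow (by positivity) (by positivity)]
        gcongr K * ?_
        exact Real.rpow_le_rpow_of_nonpos (by positivity) h2 he0
    calc _ ≤ B1 * (1 + ‖x‖) ^ e := by simpa [B1, mul_assoc] using hbd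
      _ ≤ _ := by gcongr; linarith
  · calc _ ≤ growthFactor R s ^ N * C * (1 + ‖x‖) ^ s := (hG.iterate_avgDiff hμ N).norm_le x
      _ ≤ growthFactor R s ^ N * C * (1 + T) ^ |s| := by
        gcongr
        calc (1 + ‖x‖) ^ s ≤ (1 + ‖x‖) ^ |s| :=
              Real.rpow_le_rpow_of_exponent_le (by linarith) (le_abs_self s)
          _ ≤ _ := by gcongr
      _ = B2 * (1 + T) ^ e := by
        simp only [B2]
        rw [mul_assoc _ ((1 + T) ^ (-e)), ← Real.rpow_add (by positivity)]
        simp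
      _ ≤ B2 * (1 + ‖x‖) ^ e := by
        gcongr B2 * ?_
        exact Real.rpow_le_rpow_of_nonpos (by positivity) (by linarith) he0
      _ ≤ _ := by gcongr; linarith

/-- The defect of a family converges, to a limit that depends only on the pointwise limit of the
family, as soon as a derivative of some order `N` decays like `|y|^(-d-1)` uniformly. -/
lemma exists_latticeDefect_limit (L : Submodule ℤ (EucSpace d)) [DiscreteTopology L]
    [IsZLattice ℝ L] (G₀ : EucSpace d → ℂ) (N : ℕ) :
    ∃ c : ℂ, ∀ (l : Filter ℝ) [l.IsCountablyGenerated] (G : ℝ → EucSpace d → ℂ) (s C K ρ : ℝ),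
      0 ≤ C → 0 ≤ K → 0 ≤ ρ →
      (∀ᶠ b in l, HasPolyGrowth s C (G b)) →
      (∀ᶠ b in l, ∃ C', HasPolyGrowth (-(d + 1 : ℝ)) C' (G b)) →
      (∀ᶠ b in l, ∀ y, ρ < ‖y‖ → ContDiffAt ℝ N (G b) y ∧
        ‖iteratedFDeriv ℝ N (G b) y‖ ≤ K * ‖y‖ ^ (-(d + 1 : ℝ))) →
      (∀ x, Tendsto (fun b => G b x) l (𝓝 (G₀ x))) →
      Tendsto (fun b => latticeDefect L (G b)) l (𝓝 c) := by
  obtain ⟨μ, R, _, hR, hμ, hcell⟩ := exists_fundamentalCell_average L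
  refine ⟨latticeDefect L ((avgDiff μ)^[N] G₀), ?_⟩
  intro l _ G s C K ρ hC hK hρ hG hdecay hD hlim
  have hs : -(d + 1 : ℝ) < -d := by linarith
  obtain ⟨B, hB⟩ := exists_norm_iterate_avgDiff_le (d := d) hR hμ N s C K ρ hC hK hρ
  have hlimN := tendsto_iterate_avgDiff hμ hG hlim N
  have hmain : Tendsto (fun b => latticeDefect L ((avgDiff μ)^[N] (G b))) l
      (𝓝 (latticeDefect L ((avgDiff μ)^[N] G₀))) := by
    unfold latticeDefect
    refine Tendsto.sub ?_ (Tendsto.const_mul _ ?_)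
    · refine tendsto_tsum_of_dominated_convergence
        (bound := fun z : L => B * (1 + ‖(z : EucSpace d)‖) ^ (-(d + 1 : ℝ)))
        ((summable_lattice_one_add_norm_rpow L hs).mul_left B) (fun z => hlimN z) ?_
      filter_upwards [hG, hD] with b h1 h2 z using hB (G b) h1 h2 z
    · have hint := integrable_one_add_norm (E := EucSpace d) (μ := volume) (r := (d + 1 : ℝ))
        (by simp)
      refine tendsto_integral_filter_of_dominated_convergence _ ?_ ?_ (hint.const_mul B)
        (.of_forall hlimN)
      · filter_upwards [hG] with b h1
        exact (h1.iterate_avgDiff hμ N).measurable.aestronglyMeasurable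
      · filter_upwards [hG, hD] with b h1 h2
        exact .of_forall fun x => hB (G b) h1 h2 x
  refine hmain.congr' ?_
  filter_upwards [hdecay] with b ⟨C', h'⟩
  exact h'.latticeDefect_iterate_avgDiff hs hμ hcell N

end LatticeDefect

/-! ### Cutoff functions and homogeneous functions -/

/-- The Fourier transform of a mollifier is a Schwartz function, of which the smooth cutoffs are
the dilates. -/
lemma IsMollifier.exists_schwartzMap {d : ℕ} {χ : EucSpace d → ℝ} (hχ : IsMollifier χ) :
    ∃ w : SchwartzMap (EucSpace d) ℂ, w 0 = 1 ∧
      ∀ β : ℝ, 0 < β → ∀ z, smoothCutoff χ β z = w (β • z) := by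
  have hcs : HasCompactSupport (fun x => (χ x : ℂ)) :=
    hχ.hasCompactSupport.comp_left (g := fun r : ℝ => (r : ℂ)) (by simp)
  have hsm : ContDiff ℝ (⊤ : ℕ∞) (fun x => (χ x : ℂ)) := Complex.ofRealCLM.contDiff.comp hχ.smooth
  refine ⟨𝓕 (hcs.toSchwartzMap hsm), ?_, fun β hβ z => ?_⟩
  · rw [SchwartzMap.fourier_coe, Real.fourier_eq]
    simp only [inner_zero_right, neg_zero, AddChar.map_zero_eq_one, one_smul]
    have := integral_complex_ofReal (μ := (volume : Measure (EucSpace d))) (f := χ)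
    simpa [hχ.integral_eq_one] using this
  · rw [SchwartzMap.fourier_coe, Real.fourier_eq]
    unfold smoothCutoff
    rw [Real.fourier_eq]
    have h := Measure.integral_comp_inv_smul (volume : Measure (EucSpace d))
      (fun v => Real.fourierChar (-inner ℝ v (β • z)) • (χ v : ℂ)) β
    have hβd : (0 : ℝ) < β ^ d := by positivity
    rw [finrank_euclideanSpace, Fintype.card_fin, abs_of_pos hβd] at h
    have h' : ∫ v, Real.fourierChar (-inner ℝ v (β • z)) • (χ v : ℂ)
        = (β ^ d)⁻¹ • ∫ v, Real.fourierChar (-inner ℝ (β⁻¹ • v) (β • z)) • (χ (β⁻¹ • v) : ℂ) := by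
      rw [h, smul_smul, inv_mul_cancel₀ hβd.ne', one_smul]
    simp only [HasCompactSupport.toSchwartzMap_toFun]
    rw [h', ← integral_smul]
    congr 1 with v
    have hin : inner ℝ (β⁻¹ • v) (β • z) = inner ℝ v z := by
      rw [real_inner_smul_left, real_inner_smul_right, inv_mul_cancel_left₀ hβ.ne']
    rw [hin, smul_comm]
    simp [scaledMollifier]

section Homogeneous

variable {E : Type*} [NormedAddCommGroup E] [NormedSpace ℝ E]

lemma norm_iteratedFDeriv_comp_smul_le {F : Type*} [NormedAddCommGroup F] [NormedSpace ℝ F]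
    (f : E → F) (n : ℕ) {r : ℝ} (hr : 0 < r) {y : E}
    (hy : y ≠ 0) :
    ‖iteratedFDeriv ℝ n (fun z => f (r • z)) y‖ ≤ r ^ n * ‖iteratedFDeriv ℝ n f (r • y)‖ := by
  have hU : IsOpen ({0}ᶜ : Set E) := isOpen_compl_singleton
  set e : E ≃L[ℝ] E := ContinuousLinearEquiv.smulLeft (Units.mk0 r hr.ne') with he
  have hev : ∀ z, e z = r • z := fun z => rfl
  have hpre : e ⁻¹' {0}ᶜ = {0}ᶜ := by
    ext z; simp
  have hry : r • y ≠ 0 := smul_ne_zero hr.ne' hy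
  have h := e.iteratedFDerivWithin_comp_right f hU.uniqueDiffOn (x := y) (by simpa using hy) n
  rw [hpre, iteratedFDerivWithin_of_isOpen n hU hy, hev,
    iteratedFDerivWithin_of_isOpen n hU hry] at h
  have hcomp : f ∘ e = fun z => f (r • z) := rfl
  rw [← hcomp, h]
  refine (ContinuousMultilinearMap.norm_compContinuousLinearMap_le _ _).trans ?_
  rw [mul_comm]
  gcongr
  rw [Finset.prod_const, Finset.card_univ, Fintype.card_fin]
  gcongr
  refine ContinuousLinearMap.opNorm_le_bound _ hr.le fun z => ?_
  change ‖e z‖ ≤ _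
  rw [hev, norm_smul, Real.norm_of_nonneg hr.le]

/-- The derivatives of a function that is smooth and positively homogeneous of degree `τ` off the
origin are bounded by the homogeneous weights. -/
lemma exists_norm_iteratedFDeriv_le_of_homogeneous [ProperSpace E] {f : E → ℂ} {τ : ℂ}
    (hf : ContDiffOn ℝ (⊤ : ℕ∞) f {0}ᶜ)
    (hom : ∀ r : ℝ, 0 < r → ∀ z, f (r • z) = (r : ℂ) ^ τ * f z) (n : ℕ) :
    ∃ C : ℝ, 0 ≤ C ∧ ∀ y, y ≠ 0 → ‖iteratedFDeriv ℝ n f y‖ ≤ C * ‖y‖ ^ (τ.re - n) := by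
  have hU : IsOpen ({0}ᶜ : Set E) := isOpen_compl_singleton
  have hcont : ContinuousOn (iteratedFDeriv ℝ n f) (Metric.sphere 0 1) := by
    intro y hy
    have hy0 : y ≠ 0 := by rintro rfl; simp at hy
    have h1 := (hf.contDiffAt (hU.mem_nhds hy0)).iteratedFDeriv_right (m := 0) (i := n)
      (by rw [zero_add]; exact_mod_cast le_top)
    exact h1.continuousAt.continuousWithinAt
  obtain ⟨C, hC⟩ := (isCompact_sphere (0 : E) 1).exists_bound_of_continuousOn hcont
  refine ⟨max C 0, le_max_right _ _, fun y hy => ?_⟩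
  have hr : 0 < ‖y‖ := norm_pos_iff.2 hy
  have hrinv : 0 < ‖y‖⁻¹ := inv_pos.2 hr
  have hsph : ‖y‖⁻¹ • y ∈ Metric.sphere (0 : E) 1 := by
    simp [norm_smul, hr.ne']
  have hfun : f = ((‖y‖ : ℂ) ^ τ) • fun z => f (‖y‖⁻¹ • z) := by
    funext z
    rw [Pi.smul_apply, smul_eq_mul, ← hom _ hr, smul_smul, mul_inv_cancel₀ hr.ne', one_smul]
  have hcd : ContDiffAt ℝ n (fun z => f (‖y‖⁻¹ • z)) y := by
    have h0 : ‖y‖⁻¹ • y ≠ 0 := smul_ne_zero hrinv.ne' hy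
    exact ((hf.contDiffAt (hU.mem_nhds h0)).of_le (by exact_mod_cast le_top)).comp y
      (contDiffAt_const.smul contDiffAt_id)
  have key : iteratedFDeriv ℝ n f y
      = ((‖y‖ : ℂ) ^ τ) • iteratedFDeriv ℝ n (fun z => f (‖y‖⁻¹ • z)) y := by
    conv_lhs => rw [hfun]
    exact iteratedFDeriv_const_smul_apply hcd
  rw [key, norm_smul, Complex.norm_cpow_eq_rpow_re_of_pos hr, Real.rpow_sub hr,
    Real.rpow_natCast]
  calc _ ≤ ‖y‖ ^ τ.re * (‖y‖⁻¹ ^ n * max C 0) := by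
        gcongr
        refine (norm_iteratedFDeriv_comp_smul_le f n hrinv hy).trans ?_
        gcongr
        exact (hC _ hsph).trans (le_max_left _ _)
    _ = _ := by rw [inv_pow]; field_simp

lemma SchwartzMap.exists_norm_iteratedFDeriv_comp_smul_le (w : SchwartzMap E ℂ) (n : ℕ) :
    ∃ C : ℝ, 0 ≤ C ∧ ∀ r : ℝ, 0 < r → ∀ y : E, y ≠ 0 →
      ‖iteratedFDeriv ℝ n (fun z => w (r • z)) y‖ ≤ C * ‖y‖ ^ (-(n : ℝ)) := by
  obtain ⟨C, hC0, hC⟩ := w.decay n n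
  refine ⟨C, hC0.le, fun r hr y hy => ?_⟩
  have hy' : 0 < ‖y‖ := norm_pos_iff.2 hy
  refine (norm_iteratedFDeriv_comp_smul_le w n hr hy).trans ?_
  have h := hC (r • y)
  rw [norm_smul, Real.norm_of_nonneg hr.le, mul_pow] at h
  rw [Real.rpow_neg hy'.le, Real.rpow_natCast, ← div_eq_mul_inv, le_div_iff₀ (by positivity)]
  linarith

lemma exists_norm_iteratedFDeriv_cutoff_mul_le {f : E → ℂ} {σ : ℝ}
    (hf : ContDiffOn ℝ (⊤ : ℕ∞) f {0}ᶜ)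
    (hbd : ∀ n : ℕ, ∃ C : ℝ, 0 ≤ C ∧ ∀ y, y ≠ 0 → ‖iteratedFDeriv ℝ n f y‖ ≤ C * ‖y‖ ^ (σ - n))
    (w : SchwartzMap E ℂ) (n : ℕ) :
    ∃ C : ℝ, 0 ≤ C ∧ ∀ r : ℝ, 0 < r → ∀ y : E, y ≠ 0 →
      ‖iteratedFDeriv ℝ n (fun z => w (r • z) * f z) y‖ ≤ C * ‖y‖ ^ (σ - n) := by
  have hU : IsOpen ({0}ᶜ : Set E) := isOpen_compl_singleton
  choose A hA0 hA using hbd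
  choose B hB0 hB using w.exists_norm_iteratedFDeriv_comp_smul_le
  refine ⟨∑ i ∈ Finset.range (n + 1), (n.choose i : ℝ) * B i * A (n - i),
    Finset.sum_nonneg fun i _ => mul_nonneg (mul_nonneg (Nat.cast_nonneg _) (hB0 i)) (hA0 _),
    fun r hr y hy => ?_⟩
  have hwr : ContDiff ℝ (⊤ : ℕ∞) fun z => w (r • z) :=
    (w.smooth ⊤).comp (contDiff_const_smul r)
  have h := norm_iteratedFDerivWithin_mul_le hwr.contDiffOn hf hU.uniqueDiffOn
    (x := y) hy (n := n) (by exact_mod_cast le_top)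
  rw [iteratedFDerivWithin_of_isOpen n hU hy] at h
  refine h.trans ?_
  rw [Finset.sum_mul]
  refine Finset.sum_le_sum fun i hi => ?_
  have hin : i ≤ n := Nat.lt_succ_iff.1 (Finset.mem_range.1 hi)
  have hy' : 0 < ‖y‖ := norm_pos_iff.2 hy
  rw [iteratedFDerivWithin_of_isOpen i hU hy, iteratedFDerivWithin_of_isOpen (n - i) hU hy]
  have hpow : ‖y‖ ^ (σ - n) = ‖y‖ ^ (-(i : ℝ)) * ‖y‖ ^ (σ - (n - i : ℕ)) := by
    rw [← Real.rpow_add hy', Nat.cast_sub hin]; congr 1; ring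
  have hBi := hB0 i
  have hAi := hA0 (n - i)
  calc _ ≤ (n.choose i : ℝ) * (B i * ‖y‖ ^ (-(i : ℝ))) * (A (n - i) * ‖y‖ ^ (σ - (n - i : ℕ))) := by
        gcongr
        · exact hB i r hr y hy
        · exact hA (n - i) y hy
    _ = _ := by rw [hpow]; ring

end Homogeneous

/-! ### Convergence of the local coefficients -/

section LocalCoeff

variable {d : ℕ}

/-- The form `z ↦ T(z, …, z)` divided by `|z|^ν`. -/
noncomputable def homogeneousKernel {m : ℕ}
    (T : ContinuousMultilinearMap ℝ (fun _ : Fin m => EucSpace d) ℂ) (ν : ℂ) (z : EucSpace d) : ℂ :=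
  T (fun _ => z) / (‖z‖ : ℂ) ^ ν

variable {m : ℕ} (T : ContinuousMultilinearMap ℝ (fun _ : Fin m => EucSpace d) ℂ) (ν : ℂ)

lemma contDiff_multilinear_diag {n : WithTop ℕ∞} :
    ContDiff ℝ n fun z : EucSpace d => T fun _ => z :=
  T.contDiff.comp (contDiff_pi.2 fun _ => contDiff_id)

lemma multilinear_diag_smul (r : ℝ) (z : EucSpace d) :
    T (fun _ => r • z) = (r : ℂ) ^ m * T fun _ => z := by
  have := T.map_smul_univ (fun _ => r) (fun _ => z)
  simp only [Finset.prod_const, Finset.card_univ, Fintype.card_fin] at this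
  rw [this, Complex.real_smul]
  push_cast; rfl

lemma measurable_homogeneousKernel : Measurable (homogeneousKernel T ν) := by
  have h1 : Measurable fun z : EucSpace d => T fun _ => z :=
    (contDiff_multilinear_diag T (n := 0)).continuous.measurable
  exact h1.div (by fun_prop)

lemma contDiffOn_norm_cpow : ContDiffOn ℝ (⊤ : ℕ∞) (fun z : EucSpace d => (‖z‖ : ℂ) ^ ν) {0}ᶜ := by
  have h : ContDiffOn ℝ (⊤ : ℕ∞)
      (fun z : EucSpace d => Complex.exp ((Real.log ‖z‖ : ℂ) * ν)) {0}ᶜ := by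
    intro z hz
    have hz0 : z ≠ 0 := hz
    have h1 : ContDiffAt ℝ (⊤ : ℕ∞) (fun z : EucSpace d => Real.log ‖z‖) z :=
      (contDiffAt_norm ℝ hz0).log (norm_ne_zero_iff.2 hz0)
    have h2 : ContDiffAt ℝ (⊤ : ℕ∞) (fun z : EucSpace d => (Real.log ‖z‖ : ℂ)) z :=
      Complex.ofRealCLM.contDiff.contDiffAt.comp z h1
    exact (h2.mul contDiffAt_const).cexp.contDiffWithinAt
  refine h.congr fun z hz => ?_
  have hz0 : (‖z‖ : ℂ) ≠ 0 := by simpa using hz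
  rw [Complex.cpow_def_of_ne_zero hz0, Complex.ofReal_log (norm_nonneg z)]

lemma norm_cpow_ne_zero {z : EucSpace d} (hz : z ≠ 0) : (‖z‖ : ℂ) ^ ν ≠ 0 := by
  have hz0 : (‖z‖ : ℂ) ≠ 0 := by simpa using hz
  simp [Complex.cpow_eq_zero_iff, hz0]

lemma contDiffOn_homogeneousKernel :
    ContDiffOn ℝ (⊤ : ℕ∞) (homogeneousKernel T ν) {0}ᶜ := by
  unfold homogeneousKernel
  simp only [div_eq_mul_inv]
  exact (contDiff_multilinear_diag T).contDiffOn.mul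
    ((contDiffOn_norm_cpow ν).inv fun _ hz => norm_cpow_ne_zero ν hz)

lemma homogeneousKernel_smul {r : ℝ} (hr : 0 < r) (z : EucSpace d) :
    homogeneousKernel T ν (r • z) = (r : ℂ) ^ ((m : ℂ) - ν) * homogeneousKernel T ν z := by
  have hr0 : (r : ℂ) ≠ 0 := by exact_mod_cast hr.ne'
  unfold homogeneousKernel
  rw [multilinear_diag_smul, norm_smul, Real.norm_of_nonneg hr.le, Complex.ofReal_mul,
    Complex.mul_cpow_ofReal_nonneg hr.le (norm_nonneg z), Complex.cpow_sub _ _ hr0,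
    Complex.cpow_natCast]
  ring

lemma exists_norm_homogeneousKernel_le : ∃ C : ℝ, 0 ≤ C ∧
    ∀ z, z ≠ 0 → ‖homogeneousKernel T ν z‖ ≤ C * ‖z‖ ^ ((m : ℝ) - ν.re) := by
  obtain ⟨C, hC0, hC⟩ := exists_norm_iteratedFDeriv_le_of_homogeneous
    (contDiffOn_homogeneousKernel T ν) (fun r hr z => homogeneousKernel_smul T ν hr z) 0
  exact ⟨C, hC0, fun z hz => by simpa using hC z hz⟩

lemma exists_norm_rpow_le_one_add {ε : ℝ} (hε : 0 < ε) (s : ℝ) : ∃ c : ℝ, 0 ≤ c ∧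
    ∀ r : ℝ, ε < r → r ^ s ≤ c * (1 + r) ^ s := by
  set κ := ε / (1 + ε)
  have hκ : 0 < κ := by positivity
  refine ⟨1 + κ ^ s, by positivity, fun r hr => ?_⟩
  have hr0 : 0 < r := hε.trans hr
  have h2 : 0 ≤ (1 + r) ^ s := by positivity
  have h3 : 0 ≤ κ ^ s * (1 + r) ^ s := by positivity
  rcases le_total 0 s with hs | hs
  · have := Real.rpow_le_rpow hr0.le (by linarith : r ≤ 1 + r) hs
    linarith
  · have hle : κ * (1 + r) ≤ r := by
      rw [div_mul_eq_mul_div, div_le_iff₀ (by positivity)]; nlinarith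
    have := Real.rpow_le_rpow_of_nonpos (by positivity) hle hs
    rw [Real.mul_rpow hκ.le (by positivity)] at this
    linarith

/-- The summand of the local coefficients, extended by zero to the ball `|z| ≤ ε`. -/
noncomputable def truncatedKernel (T : ContinuousMultilinearMap ℝ (fun _ : Fin m => EucSpace d) ℂ)
    (ν : ℂ) (ε : ℝ) (w : EucSpace d → ℂ) : EucSpace d → ℂ :=
  (Metric.closedBall 0 ε)ᶜ.indicator fun z => w z * homogeneousKernel T ν z

variable {ε : ℝ}

lemma hasPolyGrowth_truncatedKernel (hε : 0 < ε) (A t : ℝ) (hA : 0 ≤ A) :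
    ∃ C : ℝ, 0 ≤ C ∧ ∀ w : EucSpace d → ℂ, Continuous w →
      (∀ z, ε < ‖z‖ → ‖w z‖ ≤ A * ‖z‖ ^ t) →
      HasPolyGrowth ((m : ℝ) - ν.re + t) C (truncatedKernel T ν ε w) := by
  obtain ⟨B, hB0, hB⟩ := exists_norm_homogeneousKernel_le T ν
  obtain ⟨c, hc0, hc⟩ := exists_norm_rpow_le_one_add hε ((m : ℝ) - ν.re + t)
  refine ⟨A * B * c, by positivity, fun w hw hwA => ⟨?_, fun z => ?_⟩⟩
  · exact (hw.measurable.mul (measurable_homogeneousKernel T ν)).indicator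
      Metric.isClosed_closedBall.measurableSet.compl
  · unfold truncatedKernel
    by_cases hz : z ∈ (Metric.closedBall (0 : EucSpace d) ε)ᶜ
    · rw [Set.indicator_of_mem hz, norm_mul]
      have hz' : ε < ‖z‖ := by simpa using hz
      have hz0 : 0 < ‖z‖ := hε.trans hz'
      calc _ ≤ (A * ‖z‖ ^ t) * (B * ‖z‖ ^ ((m : ℝ) - ν.re)) := by
            gcongr
            · exact hwA z hz'
            · exact hB z (norm_pos_iff.1 hz0)
        _ = A * B * ‖z‖ ^ ((m : ℝ) - ν.re + t) := by rw [Real.rpow_add hz0]; ring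
        _ ≤ A * B * (c * (1 + ‖z‖) ^ ((m : ℝ) - ν.re + t)) := by
            gcongr; exact hc _ hz'
        _ = _ := by ring
    · rw [Set.indicator_of_notMem hz, norm_zero]
      positivity

lemma exists_hasPolyGrowth_truncatedKernel_schwartz (hε : 0 < ε)
    (w : SchwartzMap (EucSpace d) ℂ) {b : ℝ} (hb : 0 < b) :
    ∃ C, HasPolyGrowth (-(d + 1 : ℝ)) C (truncatedKernel T ν ε fun z => w (b • z)) := by
  obtain ⟨N, hN⟩ := exists_nat_ge ((m : ℝ) - ν.re + d + 1)
  obtain ⟨D, hD0, hD⟩ := w.decay N 0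
  obtain ⟨C', hC'0, hC'⟩ := hasPolyGrowth_truncatedKernel T ν hε (D * (b ^ N)⁻¹) (-N)
    (by positivity)
  have hG := hC' (fun z => w (b • z)) (w.continuous.comp (continuous_const_smul b)) fun z hz => by
    have hz0 : 0 < ‖z‖ := hε.trans hz
    have h := hD (b • z)
    rw [norm_smul, Real.norm_of_nonneg hb.le, norm_iteratedFDeriv_zero, mul_pow] at h
    rw [Real.rpow_neg hz0.le, Real.rpow_natCast, mul_assoc, ← mul_inv, ← div_eq_mul_inv,
      le_div_iff₀ (by positivity)]
    linarith
  refine ⟨C', hG.measurable, fun x => (hG.norm_le x).trans ?_⟩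
  gcongr
  · linarith [norm_nonneg x]
  · linarith

/-- Dilates of Schwartz functions regularise the defect of the truncated kernel to a limit that
depends on the Schwartz function only through its value at the origin. -/
lemma exists_latticeDefect_truncatedKernel_limit (L : Submodule ℤ (EucSpace d))
    [DiscreteTopology L] [IsZLattice ℝ L] (hε : 0 < ε) :
    ∃ c : ℂ, ∀ w : SchwartzMap (EucSpace d) ℂ, w 0 = 1 →
      Tendsto (fun b : ℝ => latticeDefect L (truncatedKernel T ν ε fun z => w (b • z)))
        (𝓝[>] 0) (𝓝 c) := by
  set σ : ℝ := (m : ℝ) - ν.re with hσ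
  -- The kernel grows with exponent `σ`, so derivatives of order `N` decay with exponent `σ - N`.
  obtain ⟨N, hN⟩ := exists_nat_ge (σ + d + 1)
  obtain ⟨c, hc⟩ := exists_latticeDefect_limit L (truncatedKernel T ν ε fun _ => 1) N
  refine ⟨c, fun w hw => ?_⟩
  have hbd : ∀ n : ℕ, ∃ C : ℝ, 0 ≤ C ∧ ∀ y, y ≠ 0 →
      ‖iteratedFDeriv ℝ n (homogeneousKernel T ν) y‖ ≤ C * ‖y‖ ^ (σ - n) := fun n => by
    simpa using exists_norm_iteratedFDeriv_le_of_homogeneous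
      (contDiffOn_homogeneousKernel T ν) (fun r hr z => homogeneousKernel_smul T ν hr z) n
  obtain ⟨K, hK0, hK⟩ := exists_norm_iteratedFDeriv_cutoff_mul_le
    (contDiffOn_homogeneousKernel T ν) hbd w N
  obtain ⟨A, hA0, hA⟩ := w.decay 0 0
  obtain ⟨C, hC0, hC⟩ := hasPolyGrowth_truncatedKernel T ν hε A 0 hA0.le
  have hcontw : ∀ b : ℝ, Continuous fun z : EucSpace d => w (b • z) := fun b =>
    w.continuous.comp (continuous_const_smul b)
  refine hc (𝓝[>] 0) _ σ C K (max ε 1) hC0 hK0 (by positivity) ?_ ?_ ?_ ?_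
  · refine .of_forall fun b => ?_
    have := hC (fun z => w (b • z)) (hcontw b) fun z _ => by simpa using hA (b • z)
    simpa using this
  · filter_upwards [self_mem_nhdsWithin] with b hb
    exact exists_hasPolyGrowth_truncatedKernel_schwartz T ν hε w hb
  · filter_upwards [self_mem_nhdsWithin] with b hb y hy
    have hb : 0 < b := hb
    have hyε : ε < ‖y‖ := (le_max_left _ _).trans_lt hy
    have hy1 : 1 < ‖y‖ := (le_max_right _ _).trans_lt hy
    have hy0 : y ≠ 0 := norm_pos_iff.1 (hε.trans hyε)
    have hev : truncatedKernel T ν ε (fun z => w (b • z)) =ᶠ[𝓝 y]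
        fun z => w (b • z) * homogeneousKernel T ν z := by
      have hopen : (Metric.closedBall (0 : EucSpace d) ε)ᶜ ∈ 𝓝 y :=
        Metric.isClosed_closedBall.isOpen_compl.mem_nhds (by simpa using hyε)
      filter_upwards [hopen] with z hz
      exact Set.indicator_of_mem hz _
    constructor
    · have h1 : ContDiffAt ℝ N (fun z => w (b • z)) y :=
        ((w.smooth N).comp (contDiff_const_smul b)).contDiffAt
      have h2 : ContDiffAt ℝ N (homogeneousKernel T ν) y :=
        ((contDiffOn_homogeneousKernel T ν).contDiffAt
          (isOpen_compl_singleton.mem_nhds hy0)).of_le (by exact_mod_cast le_top)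
      exact (h1.mul h2).congr_of_eventuallyEq hev
    · rw [(hev.iteratedFDeriv ℝ N).eq_of_nhds]
      refine (hK b hb y hy0).trans ?_
      gcongr
      · exact hy1.le
      · linarith
  · intro x
    unfold truncatedKernel
    by_cases hx : x ∈ (Metric.closedBall (0 : EucSpace d) ε)ᶜ
    · simp only [Set.indicator_of_mem hx]
      refine Tendsto.mul_const _ ?_
      have h1 : Tendsto (fun b : ℝ => w (b • x)) (𝓝 0) (𝓝 (w ((0 : ℝ) • x))) :=
        (w.continuous.comp (continuous_id.smul continuous_const)).continuousAt
      rw [zero_smul, hw] at h1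
      exact h1.mono_left nhdsWithin_le_nhds
    · simp only [Set.indicator_of_notMem hx]
      exact tendsto_const_nhds

end LocalCoeff

lemma sumIntegral_eq_latticeDefect {d : ℕ} (L : Submodule ℤ (EucSpace d)) {Ω : Set (EucSpace d)}
    (hΩ : MeasurableSet Ω) (f : EucSpace d → ℂ) :
    sumIntegral L Ω f = latticeDefect L (Ω.indicator f) := by
  unfold sumIntegral latticeDefect
  rw [integral_indicator hΩ, tsum_subtype (Ω ∩ (L : Set (EucSpace d))) f, Set.inter_comm,
    ← Set.indicator_indicator]
  congr 1
  exact (tsum_subtype (L : Set (EucSpace d)) (Ω.indicator f)).symm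

lemma localSEMCoeff_eq {d : ℕ} (L : Submodule ℤ (EucSpace d)) (χ : EucSpace d → ℝ) (ν : ℂ)
    (ε : ℝ) (k : ℕ) (g : EucSpace d → ℂ) (x : EucSpace d) (β : ℝ) :
    localSEMCoeff L χ ν ε k g x β
      = latticeDefect L (truncatedKernel (iteratedFDeriv ℝ (2 * k) g x) ν ε (smoothCutoff χ β)) :=
  sumIntegral_eq_latticeDefect L Metric.isClosed_closedBall.measurableSet.compl _

/-- The local coefficients converge, to a limit that is the same for all mollifiers. -/
lemma exists_localSEMCoeff_limit {d : ℕ} (L : Submodule ℤ (EucSpace d))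
    [DiscreteTopology L] [IsZLattice ℝ L] (ν : ℂ) {ε : ℝ} (hε : 0 < ε) (k : ℕ)
    (g : EucSpace d → ℂ) (x : EucSpace d) :
    ∃ c : ℂ, ∀ χ : EucSpace d → ℝ, IsMollifier χ →
      Tendsto (localSEMCoeff L χ ν ε k g x) (𝓝[>] 0) (𝓝 c) := by
  obtain ⟨c, hc⟩ := exists_latticeDefect_truncatedKernel_limit
    (iteratedFDeriv ℝ (2 * k) g x) ν L hε
  refine ⟨c, fun χ hχ => ?_⟩
  obtain ⟨w, hw0, hw⟩ := hχ.exists_schwartzMap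
  refine (hc w hw0).congr' ?_
  filter_upwards [self_mem_nhdsWithin] with b hb
  rw [localSEMCoeff_eq, funext (hw b hb)]

/-! ### Integrals of forms in polar coordinates -/

section Polar

variable {d m : ℕ} (T : ContinuousMultilinearMap ℝ (fun _ : Fin m => EucSpace d) ℂ)

/-- The integral of `u ↦ T(u, …, u)` over the unit sphere. -/
noncomputable def sphereIntegral : ℂ :=
  ∫ u : Metric.sphere (0 : EucSpace d) 1, T (fun _ => (u : EucSpace d))
    ∂(volume : Measure (EucSpace d)).toSphere

lemma integral_multilinear_mul_radial (hd : 0 < d) (f : ℝ → ℂ) :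
    ∫ y : EucSpace d, T (fun _ => y) * f ‖y‖
      = sphereIntegral T * ∫ r in Set.Ioi (0 : ℝ), (r : ℂ) ^ (d - 1 + m) * f r := by
  have : Nontrivial (EucSpace d) := by
    have : Nonempty (Fin d) := ⟨⟨0, hd⟩⟩
    infer_instance
  set μ : Measure (EucSpace d) := volume
  set F : Metric.sphere (0 : EucSpace d) 1 × Set.Ioi (0 : ℝ) → ℂ :=
    fun p => T (fun _ => (p.1 : EucSpace d)) * ((p.2 : ℝ) ^ m * f p.2 : ℂ) with hF
  calc ∫ y : EucSpace d, T (fun _ => y) * f ‖y‖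
      = ∫ y : ({(0)}ᶜ : Set (EucSpace d)), T (fun _ => y.1) * f ‖y.1‖ ∂(μ.comap (↑)) := by
        rw [integral_subtype_comap (measurableSet_singleton _).compl
          fun y : EucSpace d => T (fun _ => y) * f ‖y‖, restrict_compl_singleton]
    _ = ∫ y : ({(0)}ᶜ : Set (EucSpace d)), F (homeomorphUnitSphereProd _ y) ∂(μ.comap (↑)) := by
        congr 1 with y
        have hy : (‖(y : EucSpace d)‖ : ℝ) ≠ 0 := norm_ne_zero_iff.2 y.2
        have h := multilinear_diag_smul T ‖(y : EucSpace d)‖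
          (‖(y : EucSpace d)‖⁻¹ • (y : EucSpace d))
        rw [smul_smul, mul_inv_cancel₀ hy, one_smul] at h
        rw [h]
        simp only [hF, homeomorphUnitSphereProd_apply_fst_coe,
          homeomorphUnitSphereProd_apply_snd_coe]
        ring
    _ = ∫ p, F p ∂μ.toSphere.prod (.volumeIoiPow (Module.finrank ℝ (EucSpace d) - 1)) :=
        μ.measurePreserving_homeomorphUnitSphereProd.integral_comp
          (Homeomorph.measurableEmbedding _) F
    _ = sphereIntegral T * ∫ r : Set.Ioi (0 : ℝ), ((r : ℝ) ^ m * f r : ℂ)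
          ∂.volumeIoiPow (Module.finrank ℝ (EucSpace d) - 1) :=
        integral_prod_mul (fun u : Metric.sphere (0 : EucSpace d) 1 =>
          T fun _ => (u : EucSpace d)) (fun r : Set.Ioi (0 : ℝ) => ((r : ℝ) ^ m * f r : ℂ))
    _ = _ := by
        congr 1
        simp only [Measure.volumeIoiPow, ENNReal.ofReal]
        rw [integral_withDensity_eq_integral_smul,
          integral_subtype_comap measurableSet_Ioi
            fun a : ℝ => Real.toNNReal (a ^ (Module.finrank ℝ (EucSpace d) - 1)) •
              ((a : ℂ) ^ m * f a)]
        · refine setIntegral_congr_fun measurableSet_Ioi fun r hr => ?_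
          have hr : 0 < r := hr
          beta_reduce
          rw [NNReal.smul_def, Real.coe_toNNReal _ (by positivity), Complex.real_smul,
            finrank_euclideanSpace, Fintype.card_fin, pow_add]
          push_cast; ring
        · exact (measurable_subtype_coe.pow_const _).real_toNNReal

lemma setIntegral_homogeneousKernel_radial (hd : 0 < d) (ν : ℂ) {A : Set ℝ} (hA : MeasurableSet A)
    (hpos : A ⊆ Set.Ioi 0) :
    ∫ y in (fun y : EucSpace d => ‖y‖) ⁻¹' A, homogeneousKernel T ν y
      = sphereIntegral T * ∫ r in A, (r : ℂ) ^ ((d + m : ℂ) - ν - 1) := by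
  rw [← integral_indicator (measurable_norm hA)]
  have h := integral_multilinear_mul_radial T hd (A.indicator fun r => (r : ℂ) ^ (-ν))
  rw [show (∫ r in Set.Ioi (0 : ℝ), (r : ℂ) ^ (d - 1 + m) * A.indicator (fun r => (r : ℂ) ^ (-ν)) r)
      = ∫ r in A, (r : ℂ) ^ ((d + m : ℂ) - ν - 1) from ?_] at h
  · rw [← h]
    congr 1 with y
    by_cases hy : ‖y‖ ∈ A
    · rw [Set.indicator_of_mem hy, Set.indicator_of_mem (by exact hy), Complex.cpow_neg]
      rfl
    · rw [Set.indicator_of_notMem hy, Set.indicator_of_notMem (by exact hy), mul_zero]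
  · rw [← integral_indicator measurableSet_Ioi, ← integral_indicator hA]
    congr 1 with r
    by_cases hr : r ∈ A
    · have hr0 : 0 < r := hpos hr
      have hrc : (r : ℂ) ≠ 0 := by exact_mod_cast hr0.ne'
      rw [Set.indicator_of_mem (hpos hr), Set.indicator_of_mem hr, Set.indicator_of_mem hr,
        ← Complex.cpow_natCast, ← Complex.cpow_add _ _ hrc]
      congr 1
      push_cast [Nat.cast_sub (Nat.succ_le_of_lt hd)]
      ring
    · rw [Set.indicator_of_notMem hr]
      simp [Set.indicator, hr]

lemma sphereIntegral_eq_zero_of_odd (hd : 0 < d) (hm : Odd m) : sphereIntegral T = 0 := by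
  have hodd : ∀ y : EucSpace d, T (fun _ => -y) = -T fun _ => y := fun y => by
    have := multilinear_diag_smul T (-1) y
    simpa [hm.neg_one_pow] using this
  set f : ℝ → ℂ := (Set.Ioc (0 : ℝ) 1).indicator fun _ => 1
  have h := integral_multilinear_mul_radial T hd f
  have h0 : ∫ y : EucSpace d, T (fun _ => y) * f ‖y‖ = 0 := by
    have hneg := integral_neg_eq_self (fun y : EucSpace d => T (fun _ => y) * f ‖y‖) volume
    simp only [hodd, norm_neg, neg_mul, integral_neg] at hneg
    exact self_eq_neg.1 hneg.symm
  have h1 : ∫ r in Set.Ioi (0 : ℝ), (r : ℂ) ^ (d - 1 + m) * f r = 1 / ((d - 1 + m : ℕ) + 1) := by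
    have he : ∀ r : ℝ, (r : ℂ) ^ (d - 1 + m) * f r
        = (Set.Ioc (0 : ℝ) 1).indicator (fun r : ℝ => (r : ℂ) ^ (d - 1 + m)) r := fun r => by
      by_cases hr : r ∈ Set.Ioc (0 : ℝ) 1 <;> simp [f, hr]
    simp only [he]
    rw [setIntegral_indicator measurableSet_Ioc, Set.inter_eq_right.2 Set.Ioc_subset_Ioi_self,
      ← intervalIntegral.integral_of_le zero_le_one]
    have := integral_pow (a := 0) (b := 1) (d - 1 + m)
    simp only [← Complex.ofReal_pow]
    rw [intervalIntegral.integral_ofReal, this]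
    simp
  rw [h0, h1] at h
  have hne : (1 : ℂ) / ((d - 1 + m : ℕ) + 1) ≠ 0 :=
    one_div_ne_zero (Nat.cast_add_one_ne_zero _)
  exact (mul_eq_zero.1 h.symm).resolve_right hne

/-- The regularised integral of `T(y, …, y) / |y|^ν` over `|y| ≥ r`, which is also minus the
regularised integral over `|y| ≤ r`. -/
noncomputable def exteriorMoment (ν : ℂ) (r : ℝ) : ℂ :=
  sphereIntegral T * ((r : ℂ) ^ ((d + m : ℂ) - ν) / (ν - (d + m)))

lemma setIntegral_annulus_homogeneousKernel (hd : 0 < d) {ν : ℂ}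
    (hν : ν ≠ d + m ∨ Odd m) {a b : ℝ} (ha : 0 < a) (hab : a ≤ b) :
    ∫ y in Metric.closedBall 0 b \ Metric.ball 0 a, homogeneousKernel T ν y
      = exteriorMoment T ν a - exteriorMoment T ν b := by
  have hset : Metric.closedBall (0 : EucSpace d) b \ Metric.ball 0 a
      = (fun y : EucSpace d => ‖y‖) ⁻¹' Set.Icc a b := by
    ext y; simp [and_comm]
  rw [hset, setIntegral_homogeneousKernel_radial T hd ν measurableSet_Icc
    fun r hr => ha.trans_le hr.1]
  unfold exteriorMoment
  rcases hν with hν | hm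
  · rw [integral_Icc_eq_integral_Ioc, ← intervalIntegral.integral_of_le hab, integral_cpow]
    · have h1 : ν - (d + m) ≠ 0 := sub_ne_zero.2 hν
      have h2 : (d + m : ℂ) - ν ≠ 0 := sub_ne_zero.2 hν.symm
      rw [sub_add_cancel]
      field_simp
      ring
    · refine .inr ⟨fun h => hν ?_, ?_⟩
      · linear_combination -h
      · rw [Set.uIcc_of_le hab]; exact fun h => absurd h.1 (not_le.2 ha)
  -- For odd degree both sides vanish; this covers the exponent `ν = d + m`, where the quotient in
  -- `exteriorMoment` has denominator zero.
  · simp [sphereIntegral_eq_zero_of_odd T hd hm]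

lemma setIntegral_exterior_homogeneousKernel (hd : 0 < d) {ν : ℂ}
    (hν : (d + m : ℝ) < ν.re) {a : ℝ} (ha : 0 < a) :
    ∫ y in (Metric.ball 0 a)ᶜ, homogeneousKernel T ν y = exteriorMoment T ν a := by
  have hset : (Metric.ball (0 : EucSpace d) a)ᶜ
      = (fun y : EucSpace d => ‖y‖) ⁻¹' Set.Ici a := by
    ext y; simp
  rw [hset, setIntegral_homogeneousKernel_radial T hd ν measurableSet_Ici
    fun r hr => ha.trans_le hr]
  unfold exteriorMoment
  rw [integral_Ici_eq_integral_Ioi, integral_Ioi_cpow_of_lt _ ha, sub_add_cancel]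
  · congr 1
    rw [← neg_sub ν, neg_div_neg_eq]
  · simp; linarith

/-- In all cases of its definition the Hadamard moment is the regularised exterior integral of the
Taylor form. -/
lemma hadamardMoment_eq (hd : 0 < d) {ν : ℂ} {a : ℝ} (ha : 0 < a) (j : ℕ) (φ : EucSpace d → ℂ)
    (hj : (d + j : ℝ) ≤ ν.re) (hν : ν ≠ d + j ∨ Odd j) :
    hadamardMoment ν a j φ = exteriorMoment (iteratedFDeriv ℝ j φ 0) ν a := by
  set T := iteratedFDeriv ℝ j φ 0 with hT
  unfold hadamardMoment
  split_ifs with h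
  -- If `ν = d + j`, then `j` is odd and both sides vanish, whatever the domain of integration.
  · have hodd := hν.resolve_left (not_not.2 h)
    have hS := sphereIntegral_eq_zero_of_odd T hd hodd
    have hset : Metric.ball (0 : EucSpace d) 1 \ Metric.ball 0 a
        = (fun y : EucSpace d => ‖y‖) ⁻¹' Set.Ico a 1 := by
      ext y; simp [and_comm]
    have := setIntegral_homogeneousKernel_radial T hd ν measurableSet_Ico
      (fun r hr => ha.trans_le hr.1 : Set.Ico a 1 ⊆ Set.Ioi 0)
    rw [hS, zero_mul, ← hset] at this
    rw [exteriorMoment, hS, zero_mul]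
    exact this
  · have hac : (a : ℂ) ≠ 0 := by exact_mod_cast ha.ne'
    refine Tendsto.limUnder_eq ?_
    have h1 : Tendsto (fun σ : ℝ => exteriorMoment T (ν + σ) a) (𝓝 0)
        (𝓝 (exteriorMoment T (ν + (0 : ℝ)) a)) := by
      have hne : ν + ((0 : ℝ) : ℂ) - (d + j) ≠ 0 := by
        rw [Complex.ofReal_zero, add_zero]; exact sub_ne_zero.2 h
      have hcont : ContinuousAt (fun σ : ℝ => exteriorMoment T (ν + σ) a) 0 := by
        unfold exteriorMoment
        refine continuousAt_const.mul (ContinuousAt.div ?_ ?_ hne)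
        · refine ContinuousAt.const_cpow ?_ (.inl hac)
          fun_prop
        · fun_prop
      exact hcont
    rw [Complex.ofReal_zero, add_zero] at h1
    refine (h1.mono_left nhdsWithin_le_nhds).congr' ?_
    filter_upwards [self_mem_nhdsWithin] with σ hσ
    have hσ : 0 < σ := hσ
    exact (setIntegral_exterior_homogeneousKernel T hd (by simp; linarith) ha).symm

end Polar

/-! ### The Hadamard integral -/

section Hadamard

variable {d : ℕ}

lemma integrableOn_closedBall_norm_rpow (hd : 0 < d) {s : ℝ} (hs : -(d : ℝ) < s) (ε : ℝ) :
    IntegrableOn (fun y : EucSpace d => ‖y‖ ^ s) (Metric.closedBall 0 ε) := by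
  have : Nontrivial (EucSpace d) := by
    have : Nonempty (Fin d) := ⟨⟨0, hd⟩⟩
    infer_instance
  have hpos : 0 < |ε| + 1 := by positivity
  have hsub : Metric.closedBall (0 : EucSpace d) ε ⊆ Metric.ball 0 (|ε| + 1) :=
    Metric.closedBall_subset_ball (by linarith [le_abs_self ε])
  refine IntegrableOn.mono_set ?_ hsub
  rw [integrableOn_fun_norm_addHaar (μ := (volume : Measure (EucSpace d))) (f := fun r : ℝ => r ^ s)]
  have h := (intervalIntegral.integrableOn_Ioo_rpow_iff (s := (d - 1 : ℕ) + s) hpos).2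
    (by push_cast [Nat.cast_sub (Nat.succ_le_of_lt hd)]; linarith)
  refine h.congr_fun (fun r hr => ?_) measurableSet_Ioo
  beta_reduce
  rw [finrank_euclideanSpace, Fintype.card_fin, Real.rpow_add hr.1, Real.rpow_natCast, smul_eq_mul]

/-- The number of Taylor terms subtracted in the Hadamard regularisation. -/
noncomputable def hadamardOrder (d : ℕ) (ν : ℂ) : ℕ := (⌊ν.re - d⌋ + 1).toNat

lemma le_re_of_lt_hadamardOrder {ν : ℂ} {j : ℕ} (hj : j < hadamardOrder d ν) :
    (d + j : ℝ) ≤ ν.re := by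
  have h1 : (j : ℤ) ≤ ⌊ν.re - d⌋ := by unfold hadamardOrder at hj; omega
  have h2 := Int.le_floor.1 h1
  push_cast at h2
  linarith

lemma re_lt_hadamardOrder (ν : ℂ) : ν.re < d + hadamardOrder d ν := by
  have h1 : ⌊ν.re - d⌋ + 1 ≤ (hadamardOrder d ν : ℤ) := Int.self_le_toNat _
  have h2 := Int.lt_floor_add_one (ν.re - d)
  have h3 : ((⌊ν.re - d⌋ + 1 : ℤ) : ℝ) ≤ (hadamardOrder d ν : ℝ) := by exact_mod_cast h1
  push_cast at h3
  linarith

/-- The remainder of `φ` after the Taylor terms subtracted in the Hadamard regularisation. -/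
noncomputable def hadamardRemainder (ν : ℂ) (φ : EucSpace d → ℂ) (y : EucSpace d) : ℂ :=
  φ y - ∑ j ∈ Finset.range (hadamardOrder d ν),
    (1 / (j.factorial : ℂ)) * iteratedFDeriv ℝ j φ 0 fun _ => y

/-- Splitting the integral at radius `ε` gives the Hadamard integral in terms of absolutely
convergent integrals and of the moments at radius `ε`. -/
lemma hadamardIntegral_eq (hd : 0 < d) {ν : ℂ} (hν : ∀ j : ℕ, ν ≠ d + j ∨ Odd j) {ε : ℝ}
    (hε : 0 < ε) {φ : EucSpace d → ℂ} (hφ : Continuous φ)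
    (hext : IntegrableOn (fun y => φ y / (‖y‖ : ℂ) ^ ν) (Metric.closedBall 0 ε)ᶜ)
    (hrem : IntegrableOn (fun y => hadamardRemainder ν φ y / (‖y‖ : ℂ) ^ ν)
      (Metric.closedBall 0 ε)) :
    hadamardIntegral Set.univ ν φ
      = (∫ y in (Metric.closedBall 0 ε)ᶜ, φ y / (‖y‖ : ℂ) ^ ν)
        + (∫ y in Metric.closedBall 0 ε, hadamardRemainder ν φ y / (‖y‖ : ℂ) ^ ν)
        - ∑ j ∈ Finset.range (hadamardOrder d ν),
            (1 / (j.factorial : ℂ)) * exteriorMoment (iteratedFDeriv ℝ j φ 0) ν ε := by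
  refine Tendsto.limUnder_eq ?_
  have hlim : Tendsto (fun η : ℝ => ∫ y in Metric.closedBall 0 ε \ Metric.ball 0 η,
      hadamardRemainder ν φ y / (‖y‖ : ℂ) ^ ν) (𝓝[>] 0)
      (𝓝 (∫ y in Metric.closedBall 0 ε, hadamardRemainder ν φ y / (‖y‖ : ℂ) ^ ν)) := by
    have hmeas : ∀ η : ℝ, MeasurableSet (Metric.ball (0 : EucSpace d) η)ᶜ := fun η =>
      Metric.isOpen_ball.measurableSet.compl
    have heq : ∀ η : ℝ, ∫ y in Metric.closedBall (0 : EucSpace d) ε \ Metric.ball 0 η,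
        hadamardRemainder ν φ y / (‖y‖ : ℂ) ^ ν
        = ∫ y in Metric.closedBall (0 : EucSpace d) ε, (Metric.ball (0 : EucSpace d) η)ᶜ.indicator
          (fun y => hadamardRemainder ν φ y / (‖y‖ : ℂ) ^ ν) y := fun η => by
      rw [setIntegral_indicator (hmeas η), Set.sdiff_eq]
    simp only [heq]
    refine tendsto_integral_filter_of_dominated_convergence _
      (.of_forall fun η => hrem.aestronglyMeasurable.indicator (hmeas η))
      (.of_forall fun η => .of_forall fun y => ?_) hrem.norm ?_
    · exact norm_indicator_le_norm_self _ y
    · have : Nontrivial (EucSpace d) := by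
        have : Nonempty (Fin d) := ⟨⟨0, hd⟩⟩
        infer_instance
      filter_upwards [Measure.ae_ne (volume.restrict (Metric.closedBall (0 : EucSpace d) ε)) 0]
        with y hy
      refine tendsto_const_nhds.congr' ?_
      filter_upwards [Ioo_mem_nhdsGT (norm_pos_iff.2 hy)] with η hη
      rw [Set.indicator_of_mem]
      simpa using hη.2.le
  refine ((hlim.const_add (∫ y in (Metric.closedBall 0 ε)ᶜ, φ y / (‖y‖ : ℂ) ^ ν)).sub_const
    (∑ j ∈ Finset.range (hadamardOrder d ν),
      (1 / (j.factorial : ℂ)) * exteriorMoment (iteratedFDeriv ℝ j φ 0) ν ε)).congr' ?_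
  filter_upwards [Ioo_mem_nhdsGT hε] with η hη
  have hη0 : 0 < η := hη.1
  set A : Set (EucSpace d) := Metric.closedBall 0 ε \ Metric.ball 0 η with hA
  have hAc : IsCompact A := (isCompact_closedBall _ _).diff Metric.isOpen_ball
  have hA0 : A ⊆ {0}ᶜ := fun y hy h => by
    rw [Set.mem_singleton_iff] at h
    exact hy.2 (by simpa [h] using hη0)
  have hk : ∀ j : ℕ, IntegrableOn (homogeneousKernel (iteratedFDeriv ℝ j φ 0) ν) A := fun j =>
    ((contDiffOn_homogeneousKernel _ ν).continuousOn.mono hA0).integrableOn_compact hAc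
  have hφA : IntegrableOn (fun y => φ y / (‖y‖ : ℂ) ^ ν) A := by
    refine ContinuousOn.integrableOn_compact hAc (hφ.continuousOn.div
      ((contDiffOn_norm_cpow ν).continuousOn.mono hA0) fun y hy => norm_cpow_ne_zero ν (hA0 hy))
  -- On the annulus `A` the remainder is `φ` minus its Taylor forms, whose integrals are differences
  -- of moments; the moments at radius `η` cancel against the regularisation.
  have hsplit : Set.univ \ Metric.ball (0 : EucSpace d) η = A ∪ (Metric.closedBall 0 ε)ᶜ := by
    ext y
    simp only [hA, Set.mem_sdiff, Set.mem_univ, true_and, Metric.mem_ball, dist_zero_right, not_lt,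
      Set.mem_union, Metric.mem_closedBall, Set.mem_compl_iff, not_le]
    constructor
    · intro h
      rcases le_or_gt ‖y‖ ε with h' | h'
      exacts [.inl ⟨h', h⟩, .inr h']
    · rintro (h | h)
      exacts [h.2, hη.2.le.trans h.le]
  have hdisj : Disjoint A (Metric.closedBall (0 : EucSpace d) ε)ᶜ :=
    Set.disjoint_left.2 fun y hy hy' => hy' hy.1
  rw [hsplit, setIntegral_union hdisj Metric.isClosed_closedBall.measurableSet.compl hφA hext]
  have hremA : ∫ y in A, hadamardRemainder ν φ y / (‖y‖ : ℂ) ^ ν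
      = (∫ y in A, φ y / (‖y‖ : ℂ) ^ ν) - ∑ j ∈ Finset.range (hadamardOrder d ν),
        (1 / (j.factorial : ℂ)) * ∫ y in A, homogeneousKernel (iteratedFDeriv ℝ j φ 0) ν y := by
    have hpt : ∀ y, hadamardRemainder ν φ y / (‖y‖ : ℂ) ^ ν
        = φ y / (‖y‖ : ℂ) ^ ν - ∑ j ∈ Finset.range (hadamardOrder d ν),
        (1 / (j.factorial : ℂ)) * homogeneousKernel (iteratedFDeriv ℝ j φ 0) ν y := fun y => by
      unfold hadamardRemainder homogeneousKernel
      rw [sub_div, Finset.sum_div]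
      congr 1
      exact Finset.sum_congr rfl fun j _ => mul_div_assoc _ _ _
    simp only [hpt]
    rw [integral_sub hφA (integrable_finsetSum _ fun j _ => (hk j).const_mul _),
      integral_finsetSum _ fun j _ => (hk j).const_mul _]
    simp only [integral_const_mul]
  have hreg : hadamardRegularisation ν η φ = ∑ j ∈ Finset.range (hadamardOrder d ν),
      (1 / (j.factorial : ℂ)) * exteriorMoment (iteratedFDeriv ℝ j φ 0) ν η := by
    unfold hadamardRegularisation
    refine Finset.sum_congr rfl fun j hj => ?_
    rw [hadamardMoment_eq hd hη0 j φ (le_re_of_lt_hadamardOrder (Finset.mem_range.1 hj)) (hν j)]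
  have hann : ∑ j ∈ Finset.range (hadamardOrder d ν),
        (1 / (j.factorial : ℂ)) * ∫ y in A, homogeneousKernel (iteratedFDeriv ℝ j φ 0) ν y
      = (∑ j ∈ Finset.range (hadamardOrder d ν),
        (1 / (j.factorial : ℂ)) * exteriorMoment (iteratedFDeriv ℝ j φ 0) ν η)
        - ∑ j ∈ Finset.range (hadamardOrder d ν),
        (1 / (j.factorial : ℂ)) * exteriorMoment (iteratedFDeriv ℝ j φ 0) ν ε := by
    rw [← Finset.sum_sub_distrib]
    refine Finset.sum_congr rfl fun j _ => ?_
    rw [setIntegral_annulus_homogeneousKernel _ hd (hν j) hη0 hη.2.le]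
    ring
  rw [hremA, hreg, hann]
  ring

end Hadamard

/-! ### Taylor expansion along rays -/

section Taylor

lemma iteratedDeriv_comp_smul_right {E F : Type*} [NormedAddCommGroup E] [NormedSpace ℝ E]
    [NormedAddCommGroup F] [NormedSpace ℝ F] {φ : E → F} (hφ : ContDiff ℝ (⊤ : ℕ∞) φ) (j : ℕ)
    (y : E) (t : ℝ) :
    iteratedDeriv j (fun t : ℝ => φ (t • y)) t = iteratedFDeriv ℝ j φ (t • y) fun _ => y := by
  have h := (ContinuousLinearMap.toSpanSingleton ℝ y).iteratedFDeriv_comp_right hφ t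
    (i := j) (by exact_mod_cast le_top)
  have hc : φ ∘ (ContinuousLinearMap.toSpanSingleton ℝ y) = fun t : ℝ => φ (t • y) := rfl
  rw [hc] at h
  rw [iteratedDeriv_eq_iteratedFDeriv, h]
  simp

lemma iteratedDeriv_ofReal_pow (n i : ℕ) :
    iteratedDeriv i (fun t : ℝ => (t : ℂ) ^ n)
      = fun t : ℝ => (n.descFactorial i : ℂ) * t ^ (n - i) := by
  induction i with
  | zero => simp
  | succ i ih =>
    rw [iteratedDeriv_succ, ih]
    funext t
    have h : HasDerivAt (fun t : ℝ => (n.descFactorial i : ℂ) * (t : ℂ) ^ (n - i))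
        ((n.descFactorial i : ℂ) * ((n - i : ℕ) * (t : ℂ) ^ (n - i - 1) * 1)) t :=
      ((HasDerivAt.pow (hasDerivAt_id (t : ℂ)) (n - i)).comp_ofReal).const_mul _
    rw [h.deriv, Nat.descFactorial_succ, Nat.sub_sub]
    push_cast
    ring

/-- The Taylor forms of a form of degree `n` times a dilated smooth function. -/
lemma iteratedFDeriv_smul_mul_form_zero {d n : ℕ}
    (T : ContinuousMultilinearMap ℝ (fun _ : Fin n => EucSpace d) ℂ)
    {w : EucSpace d → ℂ} (hw : ContDiff ℝ (⊤ : ℕ∞) w) (b : ℝ) (j : ℕ) (y : EucSpace d) :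
    iteratedFDeriv ℝ j (fun z => w (b • z) * T fun _ => z) 0 (fun _ => y)
      = if j < n then 0 else (j.choose n * n.factorial : ℂ) * (b : ℂ) ^ (j - n) *
        ((T fun _ => y) * iteratedFDeriv ℝ (j - n) w 0 fun _ => y) := by
  have hwb : ContDiff ℝ (⊤ : ℕ∞) fun z => w (b • z) := hw.comp (contDiff_const_smul b)
  have h0 := iteratedDeriv_comp_smul_right (hwb.mul (contDiff_multilinear_diag T)) j y 0
  rw [zero_smul] at h0
  rw [← h0]
  have hfun : (fun t : ℝ => w (b • t • y) * T fun _ => t • y)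
      = fun t : ℝ => (t : ℂ) ^ n * ((T fun _ => y) * w (t • b • y)) := by
    funext t
    rw [multilinear_diag_smul, smul_comm]
    ring
  have hcw : ContDiff ℝ (⊤ : ℕ∞) fun t : ℝ => w (t • b • y) :=
    hw.comp (contDiff_id.smul contDiff_const)
  have hct : ContDiff ℝ (⊤ : ℕ∞) fun t : ℝ => (t : ℂ) ^ n := Complex.ofRealCLM.contDiff.pow n
  rw [hfun, iteratedDeriv_fun_mul (hct.contDiffAt.of_le (by exact_mod_cast le_top))
    ((contDiff_const.mul hcw).contDiffAt.of_le (by exact_mod_cast le_top))]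
  have hterm : ∀ i, i ≠ n → (j.choose i : ℂ) * iteratedDeriv i (fun t : ℝ => (t : ℂ) ^ n) 0 *
      iteratedDeriv (j - i) (fun t : ℝ => (T fun _ => y) * w (t • b • y)) 0 = 0 := by
    intro i hi
    rw [iteratedDeriv_ofReal_pow]
    rcases lt_or_gt_of_ne hi with h | h
    · simp [Nat.sub_ne_zero_of_lt h]
    · simp [Nat.descFactorial_eq_zero_iff_lt.2 h]
  split_ifs with hj
  · exact Finset.sum_eq_zero fun i hi => hterm i (by rw [Finset.mem_range] at hi; omega)
  · rw [Finset.sum_eq_single n (fun i _ hi => hterm i hi)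
      (fun h => absurd (Finset.mem_range.2 (by omega)) h), iteratedDeriv_ofReal_pow]
    have h2 : iteratedDeriv (j - n) (fun t : ℝ => (T fun _ => y) * w (t • b • y)) 0
        = (T fun _ => y) * ((b : ℂ) ^ (j - n) * iteratedFDeriv ℝ (j - n) w 0 fun _ => y) := by
      rw [iteratedDeriv_const_mul_field, iteratedDeriv_comp_smul_right hw, zero_smul,
        multilinear_diag_smul]
    rw [h2]
    simp [Nat.descFactorial_self]
    ring

lemma SchwartzMap.exists_norm_sub_taylor_le {E : Type*} [NormedAddCommGroup E] [NormedSpace ℝ E]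
    (w : SchwartzMap E ℂ) (q : ℕ) : ∃ C : ℝ, 0 ≤ C ∧ ∀ y,
      ‖w y - ∑ i ∈ Finset.range q, (1 / (i.factorial : ℂ)) * iteratedFDeriv ℝ i w 0 fun _ => y‖
        ≤ C * ‖y‖ ^ q := by
  obtain ⟨C, hC0, hC⟩ := w.decay 0 q
  refine ⟨C, hC0.le, fun y => ?_⟩
  cases q with
  | zero => simpa using hC y
  | succ p =>
    have hw : ContDiff ℝ (⊤ : ℕ∞) w := w.smooth ⊤
    have hf : ContDiff ℝ (⊤ : ℕ∞) fun t : ℝ => w (t • y) :=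
      hw.comp (contDiff_id.smul contDiff_const)
    have hder : ∀ i : ℕ, ∀ t ∈ Set.Icc (0 : ℝ) 1,
        iteratedDerivWithin i (fun t : ℝ => w (t • y)) (Set.Icc 0 1) t
          = iteratedFDeriv ℝ i w (t • y) fun _ => y := fun i t ht => by
      rw [iteratedDerivWithin_eq_iteratedDeriv (uniqueDiffOn_Icc zero_lt_one)
        (hf.contDiffAt.of_le (by exact_mod_cast le_top)) ht, iteratedDeriv_comp_smul_right hw]
    have h := taylor_mean_remainder_bound (f := fun t : ℝ => w (t • y)) (a := 0) (b := 1)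
      (x := 1) (n := p) (C := C * ‖y‖ ^ (p + 1)) zero_le_one
      (hf.contDiffOn.of_le (by exact_mod_cast le_top)) (by simp) fun t ht => by
        rw [hder _ t ht]
        refine (ContinuousMultilinearMap.le_opNorm _ _).trans ?_
        rw [Finset.prod_const, Finset.card_univ, Fintype.card_fin]
        gcongr
        simpa using hC (t • y)
    rw [taylor_within_apply] at h
    have hsum : ∀ i ∈ Finset.range (p + 1), (((i.factorial : ℝ)⁻¹ * (1 - 0) ^ i) •
        iteratedDerivWithin i (fun t : ℝ => w (t • y)) (Set.Icc 0 1) 0)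
        = (1 / (i.factorial : ℂ)) * iteratedFDeriv ℝ i w 0 fun _ => y := fun i _ => by
      rw [hder i 0 (by simp), zero_smul]
      simp
    rw [Finset.sum_congr rfl hsum, one_smul, sub_zero, one_pow, mul_one] at h
    refine h.trans (div_le_self (by positivity) ?_)
    exact_mod_cast Nat.succ_le_of_lt p.factorial_pos

end Taylor

/-! ### The Hadamard integral as the cutoff is removed -/

section CutoffLimit

variable {d n : ℕ} (T : ContinuousMultilinearMap ℝ (fun _ : Fin n => EucSpace d) ℂ)

lemma hadamardRemainder_smul_mul_form (ν : ℂ) {w : EucSpace d → ℂ}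
    (hw : ContDiff ℝ (⊤ : ℕ∞) w) (b : ℝ) (y : EucSpace d) :
    hadamardRemainder ν (fun z => w (b • z) * T fun _ => z) y
      = (w (b • y) - ∑ i ∈ Finset.range (hadamardOrder d ν - n),
          (1 / (i.factorial : ℂ)) * iteratedFDeriv ℝ i w 0 fun _ => b • y) * T fun _ => y := by
  unfold hadamardRemainder
  simp only [iteratedFDeriv_smul_mul_form_zero T hw]
  rw [sub_mul]
  congr 1
  rcases le_total (hadamardOrder d ν) n with h | h
  · rw [Nat.sub_eq_zero_of_le h, Finset.sum_range_zero, zero_mul]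
    refine Finset.sum_eq_zero fun j hj => ?_
    rw [if_pos ((Finset.mem_range.1 hj).trans_le h), mul_zero]
  · obtain ⟨q, hq⟩ := Nat.exists_eq_add_of_le h
    rw [hq, Nat.add_sub_cancel_left, Finset.sum_range_add, Finset.sum_mul,
      Finset.sum_eq_zero fun j hj => by rw [if_pos (Finset.mem_range.1 hj), mul_zero], zero_add]
    refine Finset.sum_congr rfl fun i _ => ?_
    have hc : (((n + i).choose n * n.factorial * i.factorial : ℕ) : ℂ) = (n + i).factorial := by
      rw [Nat.add_comm n i, mul_right_comm, Nat.add_choose_mul_factorial_mul_factorial]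
    push_cast at hc
    have h1 : ((n + i).factorial : ℂ) ≠ 0 := by exact_mod_cast (n + i).factorial_ne_zero
    have h2 : (i.factorial : ℂ) ≠ 0 := by exact_mod_cast i.factorial_ne_zero
    rw [if_neg (by omega), Nat.add_sub_cancel_left, multilinear_diag_smul]
    field_simp
    rw [← hc]
    ring

lemma tendsto_exteriorMoment_smul_mul_form (ν : ℂ) (ε : ℝ) {w : EucSpace d → ℂ}
    (hw : ContDiff ℝ (⊤ : ℕ∞) w) (hw0 : w 0 = 1) (j : ℕ) :
    Tendsto (fun b : ℝ => (1 / (j.factorial : ℂ)) *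
      exteriorMoment (iteratedFDeriv ℝ j (fun z => w (b • z) * T fun _ => z) 0) ν ε)
      (𝓝[>] 0) (𝓝 (if j = n then exteriorMoment T ν ε else 0)) := by
  set c : ℂ := ∫ u : Metric.sphere (0 : EucSpace d) 1, (T (fun _ => (u : EucSpace d)) *
    iteratedFDeriv ℝ (j - n) w 0 fun _ => (u : EucSpace d))
    ∂(volume : Measure (EucSpace d)).toSphere with hc
  have hS : ∀ b : ℝ, sphereIntegral (iteratedFDeriv ℝ j (fun z => w (b • z) * T fun _ => z) 0)
      = if j < n then 0 else (j.choose n * n.factorial : ℂ) * (b : ℂ) ^ (j - n) * c := fun b => by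
    unfold sphereIntegral
    simp only [iteratedFDeriv_smul_mul_form_zero T hw]
    split_ifs with h
    · simp
    · rw [integral_const_mul]
  unfold exteriorMoment
  simp only [hS]
  rcases lt_trichotomy j n with h | h | h
  · simp [h, h.ne]
  · subst h
    have hcT : c = sphereIntegral T := by
      rw [hc, Nat.sub_self]
      simp [sphereIntegral, hw0]
    have h1 : (j.factorial : ℂ) ≠ 0 := by exact_mod_cast j.factorial_ne_zero
    simp only [lt_irrefl, if_false, if_true, Nat.sub_self, pow_zero, mul_one, Nat.choose_self,
      Nat.cast_one, one_mul, hcT]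
    refine tendsto_const_nhds.congr fun b => ?_
    field_simp
  · simp only [if_neg h.ne', if_neg h.not_gt]
    have hb : Tendsto (fun b : ℝ => (b : ℂ) ^ (j - n)) (𝓝 0) (𝓝 0) := by
      have : Continuous fun b : ℝ => (b : ℂ) ^ (j - n) := by fun_prop
      have h0 := this.tendsto 0
      rwa [Complex.ofReal_zero, zero_pow (Nat.sub_ne_zero_of_lt h)] at h0
    have := (((hb.const_mul (j.choose n * n.factorial : ℂ)).mul_const c).mul_const
      ((ε : ℂ) ^ ((d + j : ℂ) - ν) / (ν - (d + j)))).const_mul (1 / (j.factorial : ℂ))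
    simp only [mul_zero, zero_mul] at this
    exact this.mono_left nhdsWithin_le_nhds

lemma setIntegral_closedBall_homogeneousKernel (hd : 0 < d) {ν : ℂ}
    (hν : ν.re < d + n) {ε : ℝ} (hε : 0 < ε) :
    ∫ y in Metric.closedBall 0 ε, homogeneousKernel T ν y = -exteriorMoment T ν ε := by
  have : Nontrivial (EucSpace d) := by
    have : Nonempty (Fin d) := ⟨⟨0, hd⟩⟩
    infer_instance
  have hset : (Metric.closedBall (0 : EucSpace d) ε \ {0} : Set (EucSpace d))
      = (fun y : EucSpace d => ‖y‖) ⁻¹' Set.Ioc 0 ε := by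
    ext y; simp [and_comm]
  have hae : (Metric.closedBall (0 : EucSpace d) ε \ {0} : Set (EucSpace d))
      =ᵐ[volume] Metric.closedBall (0 : EucSpace d) ε :=
    sdiff_null_ae_eq_self (measure_singleton _)
  rw [← setIntegral_congr_set hae, hset,
    setIntegral_homogeneousKernel_radial T hd ν measurableSet_Ioc fun r hr => hr.1,
    ← intervalIntegral.integral_of_le hε.le, integral_cpow (.inl (by simp; linarith))]
  have h1 : ((d + n : ℂ) - ν) ≠ 0 := fun h => by
    have := congrArg Complex.re h
    simp at this
    linarith
  unfold exteriorMoment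
  rw [sub_add_cancel, Complex.ofReal_zero, Complex.zero_cpow h1, sub_zero, ← mul_neg, ← div_neg,
    neg_sub]

/-- As the cutoff is removed, the contribution of the ball `|y| ≤ ε` to the Hadamard integral
tends to the finite part of the integral of the kernel over that ball. -/
lemma tendsto_hadamardIntegral_sub (hd : 0 < d) {ν : ℂ} (hν : ∀ j : ℕ, ν ≠ d + j ∨ Odd j) {ε : ℝ}
    (hε : 0 < ε) (w : SchwartzMap (EucSpace d) ℂ) (hw0 : w 0 = 1) :
    Tendsto (fun b : ℝ => hadamardIntegral Set.univ ν (fun z => w (b • z) * T fun _ => z)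
        - ∫ y in (Metric.closedBall 0 ε)ᶜ, w (b • y) * homogeneousKernel T ν y)
      (𝓝[>] 0) (𝓝 (-exteriorMoment T ν ε)) := by
  have : Nontrivial (EucSpace d) := by
    have : Nonempty (Fin d) := ⟨⟨0, hd⟩⟩
    infer_instance
  have hw : ContDiff ℝ (⊤ : ℕ∞) w := w.smooth ⊤
  -- The regularisation subtracts `q` Taylor terms of `w`. If `q = 0`, the kernel is integrable near
  -- the origin and its integral is the limit; otherwise the remainder integral is `O(b ^ q)` and the
  -- limit comes from the moment of degree `n`.
  set M := hadamardOrder d ν with hM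
  set q := M - n with hq
  have hqn : ν.re < d + (n + q : ℕ) := by
    have h1 := re_lt_hadamardOrder (d := d) ν
    have h2 : (M : ℝ) ≤ (n + q : ℕ) := by exact_mod_cast (by omega : M ≤ n + q)
    linarith
  obtain ⟨C, hC0, hC⟩ := w.exists_norm_sub_taylor_le q
  set rem : ℝ → EucSpace d → ℂ := fun b y =>
    hadamardRemainder ν (fun z => w (b • z) * T fun _ => z) y / (‖y‖ : ℂ) ^ ν with hrem
  have hcontφ : ∀ b : ℝ, Continuous fun z : EucSpace d => w (b • z) * T fun _ => z := fun b =>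
    (w.continuous.comp (continuous_const_smul b)).mul
      (contDiff_multilinear_diag T (n := 0)).continuous
  have hae : ∀ᵐ y ∂volume.restrict (Metric.closedBall (0 : EucSpace d) ε), y ≠ 0 :=
    Measure.ae_ne _ 0
  have hmeas : ∀ b, AEStronglyMeasurable (rem b)
      (volume.restrict (Metric.closedBall (0 : EucSpace d) ε)) := fun b => by
    have h1 : Measurable (hadamardRemainder ν fun z : EucSpace d => w (b • z) * T fun _ => z) := by
      refine ((hcontφ b).sub ?_).measurable
      exact continuous_finsetSum _ fun j _ => continuous_const.mul
        (contDiff_multilinear_diag _ (n := 0)).continuous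
    exact (h1.div (by fun_prop)).aestronglyMeasurable
  have hbound : ∀ b : ℝ, 0 < b → ∀ y, y ≠ 0 →
      ‖rem b y‖ ≤ b ^ q * (C * ‖T‖ * ‖y‖ ^ ((n + q : ℕ) - ν.re)) := fun b hb y hy => by
    have hy0 : 0 < ‖y‖ := norm_pos_iff.2 hy
    simp only [hrem]
    rw [hadamardRemainder_smul_mul_form T ν hw, norm_div,
      Complex.norm_cpow_eq_rpow_re_of_pos hy0, norm_mul, Real.rpow_sub hy0, Real.rpow_natCast,
      div_le_iff₀ (by positivity)]
    have hT : ‖T fun _ => y‖ ≤ ‖T‖ * ‖y‖ ^ n := by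
      have := T.le_opNorm fun _ => y
      simpa using this
    have h1 := hC (b • y)
    rw [norm_smul, Real.norm_of_nonneg hb.le, mul_pow] at h1
    calc _ ≤ (C * (b ^ q * ‖y‖ ^ q)) * (‖T‖ * ‖y‖ ^ n) := by gcongr
      _ = _ := by
        have : ‖y‖ ^ ν.re ≠ 0 := (Real.rpow_pos_of_pos hy0 _).ne'
        field_simp
        ring
  have hint : IntegrableOn (fun y : EucSpace d => C * ‖T‖ * ‖y‖ ^ ((n + q : ℕ) - ν.re))
      (Metric.closedBall 0 ε) :=
    (integrableOn_closedBall_norm_rpow hd (by linarith) ε).const_mul _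
  have hremint : ∀ b, 0 < b → IntegrableOn (rem b) (Metric.closedBall 0 ε) := fun b hb =>
    (hint.const_mul (b ^ q)).mono' (hmeas b) (by
      filter_upwards [hae] with y hy using hbound b hb y hy)
  have hext : ∀ b : ℝ, 0 < b → IntegrableOn
      (fun y : EucSpace d => (w (b • y) * T fun _ => y) / (‖y‖ : ℂ) ^ ν)
      (Metric.closedBall 0 ε)ᶜ := fun b hb => by
    obtain ⟨C', hC'⟩ := exists_hasPolyGrowth_truncatedKernel_schwartz T ν hε w hb
    have h := hC'.integrable (by linarith)
    unfold truncatedKernel at h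
    rw [integrable_indicator_iff Metric.isClosed_closedBall.measurableSet.compl] at h
    refine h.congr_fun (fun y _ => ?_) Metric.isClosed_closedBall.measurableSet.compl
    exact (mul_div_assoc _ _ _).symm
  have hlimrem : Tendsto (fun b => ∫ y in Metric.closedBall 0 ε, rem b y) (𝓝[>] 0)
      (𝓝 (∫ y in Metric.closedBall 0 ε, if q = 0 then homogeneousKernel T ν y else 0)) := by
    refine tendsto_integral_filter_of_dominated_convergence _ (.of_forall hmeas) ?_ hint ?_
    · filter_upwards [Ioo_mem_nhdsGT (zero_lt_one' ℝ)] with b hb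
      filter_upwards [hae] with y hy
      refine (hbound b hb.1 y hy).trans (mul_le_of_le_one_left (by positivity) ?_)
      exact pow_le_one₀ hb.1.le hb.2.le
    · filter_upwards [hae] with y hy
      split_ifs with h0
      · have h1 : Tendsto (fun b : ℝ => w (b • y)) (𝓝 0) (𝓝 (w ((0 : ℝ) • y))) :=
          (w.continuous.comp (continuous_id.smul continuous_const)).continuousAt
        rw [zero_smul, hw0] at h1
        have h2 := (h1.mono_left nhdsWithin_le_nhds : Tendsto _ (𝓝[>] (0 : ℝ)) _).mul_const
          (homogeneousKernel T ν y)
        rw [one_mul] at h2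
        refine h2.congr fun b => ?_
        simp only [hrem]
        rw [hadamardRemainder_smul_mul_form T ν hw, ← hM, ← hq, h0, Finset.sum_range_zero, sub_zero,
          mul_div_assoc]
        rfl
      · have h1 : Tendsto (fun b : ℝ => b ^ q * (C * ‖T‖ * ‖y‖ ^ ((n + q : ℕ) - ν.re)))
            (𝓝[>] 0) (𝓝 0) := by
          have : Continuous fun b : ℝ => b ^ q * (C * ‖T‖ * ‖y‖ ^ ((n + q : ℕ) - ν.re)) := by
            fun_prop
          have h2 := this.tendsto 0
          rw [zero_pow h0, zero_mul] at h2
          exact h2.mono_left nhdsWithin_le_nhds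
        refine squeeze_zero_norm' ?_ h1
        filter_upwards [self_mem_nhdsWithin] with b hb using hbound b hb y hy
  have hlimsum : Tendsto (fun b : ℝ => ∑ j ∈ Finset.range M, (1 / (j.factorial : ℂ)) *
      exteriorMoment (iteratedFDeriv ℝ j (fun z => w (b • z) * T fun _ => z) 0) ν ε)
      (𝓝[>] 0) (𝓝 (∑ j ∈ Finset.range M, if j = n then exteriorMoment T ν ε else 0)) :=
    tendsto_finsetSum _ fun j _ => tendsto_exteriorMoment_smul_mul_form T ν ε hw hw0 j
  have hval : (∫ y in Metric.closedBall 0 ε, if q = 0 then homogeneousKernel T ν y else 0)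
      - (∑ j ∈ Finset.range M, if j = n then exteriorMoment T ν ε else 0)
      = -exteriorMoment T ν ε := by
    rw [Finset.sum_ite_eq' (Finset.range M) n fun _ => exteriorMoment T ν ε]
    by_cases h0 : q = 0
    · have hn : n ∉ Finset.range M := by rw [Finset.mem_range]; omega
      simp only [h0, if_true, if_neg hn, sub_zero]
      refine setIntegral_closedBall_homogeneousKernel T hd ?_ hε
      simpa [h0] using hqn
    · have hn : n ∈ Finset.range M := by rw [Finset.mem_range]; omega
      rw [if_pos hn]
      simp [h0]
  rw [← hval]
  refine (hlimrem.sub hlimsum).congr' ?_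
  filter_upwards [self_mem_nhdsWithin] with b hb
  rw [hadamardIntegral_eq hd hν hε (hcontφ b) (hext b hb) (hremint b hb)]
  have hk : ∀ y : EucSpace d, (w (b • y) * T fun _ => y) / (‖y‖ : ℂ) ^ ν
      = w (b • y) * homogeneousKernel T ν y := fun y => mul_div_assoc _ _ _
  simp only [hk]
  ring

end CutoffLimit

/-! ### Differentiating the Taylor forms -/

section TaylorForms

variable {E : Type} [NormedAddCommGroup E] [NormedSpace ℝ E]

lemma iteratedFDeriv_clm_apply_const {F G : Type*} [NormedAddCommGroup F] [NormedSpace ℝ F]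
    [NormedAddCommGroup G] [NormedSpace ℝ G] {c : E → F →L[ℝ] G} {x : E} {n : ℕ}
    (hc : ContDiffAt ℝ n c x) (v : F) (m : Fin n → E) :
    iteratedFDeriv ℝ n (fun z => c z v) x m = iteratedFDeriv ℝ n c x m v := by
  have h := (ContinuousLinearMap.apply ℝ G v).iteratedFDeriv_comp_left hc (i := n) le_rfl
  have := congrArg (fun A => A m) h
  exact this

/-- The derivative of the Taylor form `y ↦ D^{n+1} h(x)(y, …, y)` in the direction `v` is `n + 1`
times the Taylor form of degree `n` of `∂_v h`. The induction only uses the symmetry of the second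
derivative, applied to the derivatives of `h`. -/
lemma fderiv_iteratedFDeriv_diag (n : ℕ) :
    ∀ {F : Type} [NormedAddCommGroup F] [NormedSpace ℝ F] {h : E → F} {x : E},
    ContDiffAt ℝ (n + 1 : ℕ) h x → ∀ v y : E,
    fderiv ℝ (fun y => iteratedFDeriv ℝ (n + 1) h x fun _ => y) y v
      = (n + 1 : ℝ) • iteratedFDeriv ℝ n (fun z => fderiv ℝ h z v) x fun _ => y := by
  induction n with
  | zero =>
    intro F _ _ h x hh v y
    have : (fun y => iteratedFDeriv ℝ (0 + 1) h x fun _ => y) = fderiv ℝ h x := by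
      funext y
      rw [zero_add, iteratedFDeriv_one_apply]
    rw [this, ContinuousLinearMap.fderiv]
    simp
  | succ n ih =>
    intro F _ _ h x hh v y
    have hD : ContDiffAt ℝ (n + 1 : ℕ) (fderiv ℝ h) x :=
      hh.fderiv_right (by norm_cast)
    have hsplit : (fun y => iteratedFDeriv ℝ (n + 1 + 1) h x fun _ => y)
        = fun y => (iteratedFDeriv ℝ (n + 1) (fderiv ℝ h) x fun _ => y) y := by
      funext y
      rw [iteratedFDeriv_succ_apply_right]
      rfl
    have hdiff : DifferentiableAt ℝ
        (fun y => iteratedFDeriv ℝ (n + 1) (fderiv ℝ h) x fun _ => y) y := by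
      have h1 : ContDiff ℝ 1 fun y => iteratedFDeriv ℝ (n + 1) (fderiv ℝ h) x fun _ => y :=
        (iteratedFDeriv ℝ (n + 1) (fderiv ℝ h) x).contDiff.comp (contDiff_pi.2 fun _ => contDiff_id)
      exact (h1.differentiable one_ne_zero).differentiableAt
    rw [hsplit, fderiv_clm_apply hdiff differentiableAt_fun_id]
    simp only [fderiv_fun_id, add_apply, ContinuousLinearMap.comp_apply,
      ContinuousLinearMap.flip_apply, ContinuousLinearMap.id_apply]
    rw [ih hD v y, ← iteratedFDeriv_clm_apply_const hD v]
    have hsymm : (fun z => fderiv ℝ (fderiv ℝ h) z v)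
        =ᶠ[𝓝 x] fun z => fderiv ℝ (fun z => fderiv ℝ h z v) z := by
      filter_upwards [hh.eventually (by simp)] with z hz
      have hs : IsSymmSndFDerivAt ℝ h z := hz.isSymmSndFDerivAt (by
        rw [minSmoothness_of_isRCLikeNormedField]; norm_cast; omega)
      have hd : DifferentiableAt ℝ (fderiv ℝ h) z :=
        (hz.fderiv_right (m := 1) (by norm_cast; omega)).differentiableAt one_ne_zero
      ext u
      rw [fderiv_clm_apply hd (differentiableAt_const v)]
      simpa using hs.eq v u
    have h2 : (iteratedFDeriv ℝ n (fun z => fderiv ℝ (fderiv ℝ h) z v) x fun _ => y) y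
        = iteratedFDeriv ℝ (n + 1) (fun z => fderiv ℝ h z v) x fun _ => y := by
      rw [(hsymm.iteratedFDeriv ℝ n).eq_of_nhds, iteratedFDeriv_succ_apply_right]
      rfl
    rw [smul_apply, h2]
    push_cast
    module

end TaylorForms

/-! ### Gaussian averages of Taylor forms -/

section Gaussian

variable {d : ℕ}

/-- The Gaussian weight `exp(-|y|²)`. -/
noncomputable def gaussWeight (y : EucSpace d) : ℂ := (Real.exp (-‖y‖ ^ 2) : ℝ)

lemma hasFDerivAt_gaussWeight (y : EucSpace d) :
    HasFDerivAt (gaussWeight : EucSpace d → ℂ)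
      (Complex.ofRealCLM.comp (Real.exp (-‖y‖ ^ 2) • -(2 • innerSL ℝ y))) y :=
  Complex.ofRealCLM.hasFDerivAt.comp y
    (hasStrictFDerivAt_norm_sq y).hasFDerivAt.neg.exp

lemma integrable_mul_gaussWeight (hd : 0 < d) {f : EucSpace d → ℂ} (hf : Continuous f) {C : ℝ}
    {k : ℕ} (hC : ∀ y, ‖f y‖ ≤ C * ‖y‖ ^ k) : Integrable fun y => f y * gaussWeight y := by
  have : Nontrivial (EucSpace d) := by
    have : Nonempty (Fin d) := ⟨⟨0, hd⟩⟩
    infer_instance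
  have h1 : Integrable (fun y : EucSpace d => ‖y‖ ^ k * Real.exp (-‖y‖ ^ 2)) := by
    rw [integrable_fun_norm_addHaar (μ := (volume : Measure (EucSpace d)))
      (f := fun r : ℝ => r ^ k * Real.exp (-r ^ 2))]
    have h := (integrable_rpow_mul_exp_neg_mul_sq zero_lt_one
      (s := (d - 1 + k : ℕ)) (by linarith [Nat.cast_nonneg (α := ℝ) (d - 1 + k)])).integrableOn
      (s := Set.Ioi 0)
    refine h.congr_fun (fun r hr => ?_) measurableSet_Ioi
    beta_reduce
    rw [finrank_euclideanSpace, Fintype.card_fin, Real.rpow_natCast, pow_add, smul_eq_mul,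
      neg_one_mul]
    ring
  have hγ : Continuous (gaussWeight : EucSpace d → ℂ) := by unfold gaussWeight; fun_prop
  refine (h1.const_mul C).mono' (hf.mul hγ).aestronglyMeasurable (.of_forall fun y => ?_)
  have hn : ‖(gaussWeight y : ℂ)‖ = Real.exp (-‖y‖ ^ 2) := by
    unfold gaussWeight
    rw [Complex.norm_real, Real.norm_of_nonneg (Real.exp_pos _).le]
  rw [norm_mul, hn, ← mul_assoc]
  gcongr
  exact hC y

lemma norm_multilinear_diag_le {m : ℕ}
    (T : ContinuousMultilinearMap ℝ (fun _ : Fin m => EucSpace d) ℂ) (y : EucSpace d) :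
    ‖T fun _ => y‖ ≤ ‖T‖ * ‖y‖ ^ m := by
  simpa using T.le_opNorm fun _ => y

lemma integral_inner_mul_form_mul_gaussWeight (hd : 0 < d) {m : ℕ}
    (T : ContinuousMultilinearMap ℝ (fun _ : Fin (m + 1) => EucSpace d) ℂ)
    (S : ContinuousMultilinearMap ℝ (fun _ : Fin m => EucSpace d) ℂ) (c : ℝ) (e : EucSpace d)
    (h : ∀ y, fderiv ℝ (fun y => T fun _ => y) y e = c • S fun _ => y) :
    ∫ y, ((inner ℝ y e : ℝ) : ℂ) * (T fun _ => y) * gaussWeight y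
      = (c / 2) * ∫ y, (S fun _ => y) * gaussWeight y := by
  have hTc : Continuous fun y : EucSpace d => T fun _ => y :=
    (contDiff_multilinear_diag T (n := 0)).continuous
  have hSc : Continuous fun y : EucSpace d => S fun _ => y :=
    (contDiff_multilinear_diag S (n := 0)).continuous
  have hγ : ∀ y : EucSpace d, fderiv ℝ (gaussWeight : EucSpace d → ℂ) y e
      = -2 * ((inner ℝ y e : ℝ) : ℂ) * gaussWeight y := fun y => by
    rw [(hasFDerivAt_gaussWeight y).fderiv]
    simp [gaussWeight]
    ring
  have hI1 : Integrable fun y : EucSpace d =>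
      (fderiv ℝ (fun y => T fun _ => y) y e) * gaussWeight y := by
    simp only [h, Complex.real_smul, mul_assoc]
    exact (integrable_mul_gaussWeight hd hSc (norm_multilinear_diag_le S)).const_mul _
  have hI2 : Integrable fun y : EucSpace d =>
      (T fun _ => y) * fderiv ℝ (gaussWeight : EucSpace d → ℂ) y e := by
    have := integrable_mul_gaussWeight hd (f := fun y => ((inner ℝ y e : ℝ) : ℂ) * T fun _ => y)
      (by fun_prop) (C := ‖e‖ * ‖T‖) (k := m + 1 + 1) fun y => by
        rw [norm_mul, Complex.norm_real]
        calc _ ≤ (‖y‖ * ‖e‖) * (‖T‖ * ‖y‖ ^ (m + 1)) := by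
              gcongr
              · exact norm_inner_le_norm y e
              · exact norm_multilinear_diag_le T y
          _ = _ := by ring
    refine (this.const_mul (-2)).congr (.of_forall fun y => ?_)
    simp only [hγ]
    ring
  have hibp := integral_mul_fderiv_eq_neg_fderiv_mul_of_integrable (μ := volume) hI1 hI2
    (integrable_mul_gaussWeight hd hTc (norm_multilinear_diag_le T))
    (fun y _ => ((contDiff_multilinear_diag T (n := 1)).differentiable one_ne_zero).differentiableAt)
    (fun y _ => (hasFDerivAt_gaussWeight y).differentiableAt)
  simp only [hγ, h, Complex.real_smul, mul_assoc] at hibp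
  have hl : ∀ y : EucSpace d, (T fun _ => y) * (-2 * (((inner ℝ y e : ℝ) : ℂ) * gaussWeight y))
      = -2 * (((inner ℝ y e : ℝ) : ℂ) * ((T fun _ => y) * gaussWeight y)) := fun y => by ring
  simp only [hl] at hibp
  rw [integral_const_mul, integral_const_mul] at hibp
  simp only [mul_assoc]
  linear_combination (-1 / 2) * hibp

lemma laplacian_eventuallyEq {h : EucSpace d → ℂ} {x : EucSpace d} (hh : ContDiffAt ℝ 2 h x) :
    (Δ h) =ᶠ[𝓝 x] fun z => ∑ i,
      fderiv ℝ (fun z => fderiv ℝ h z (EuclideanSpace.basisFun (Fin d) ℝ i)) z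
        (EuclideanSpace.basisFun (Fin d) ℝ i) := by
  filter_upwards [hh.eventually (by simp)] with z hz
  rw [InnerProductSpace.laplacian_eq_iteratedFDeriv_orthonormalBasis h
    (EuclideanSpace.basisFun (Fin d) ℝ)]
  refine Finset.sum_congr rfl fun i _ => ?_
  have hdz : DifferentiableAt ℝ (fderiv ℝ h) z :=
    (hz.fderiv_right (m := 1) (by norm_num)).differentiableAt one_ne_zero
  rw [iteratedFDeriv_two_apply, fderiv_clm_apply hdz (differentiableAt_const _)]
  simp

lemma contDiffAt_fderiv_apply {n : ℕ} {h : EucSpace d → ℂ} {x : EucSpace d}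
    (hh : ContDiffAt ℝ (n + 1 : ℕ) h x) (v : EucSpace d) :
    ContDiffAt ℝ n (fun z => fderiv ℝ h z v) x :=
  (hh.fderiv_right (by norm_cast)).clm_apply contDiffAt_const

lemma contDiffAt_laplacian {n : ℕ} {h : EucSpace d → ℂ} {x : EucSpace d}
    (hh : ContDiffAt ℝ (n + 2 : ℕ) h x) : ContDiffAt ℝ n (Δ h) x := by
  have h2 : ContDiffAt ℝ 2 h x := hh.of_le (by norm_cast; omega)
  refine ContDiffAt.congr_of_eventuallyEq ?_ (laplacian_eventuallyEq h2)
  exact ContDiffAt.sum fun i _ =>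
    contDiffAt_fderiv_apply (contDiffAt_fderiv_apply (n := n + 1) hh _) _

/-- Gaussian integration by parts lowers the degree of a Taylor form by two and applies the
Laplacian. -/
lemma integral_taylorForm_gauss_step (hd : 0 < d) {n : ℕ} {h : EucSpace d → ℂ} {x : EucSpace d}
    (hh : ContDiffAt ℝ (n + 2 : ℕ) h x) :
    ∫ y, dirDeriv (n + 2) y h x * gaussWeight y
      = ((n + 1) / 2 : ℂ) * ∫ y, dirDeriv n y (Δ h) x * gaussWeight y := by
  set e := EuclideanSpace.basisFun (Fin d) ℝ with he
  have hD : ContDiffAt ℝ (n + 1 : ℕ) (fderiv ℝ h) x := hh.fderiv_right (by norm_cast)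
  have h1 : ∀ i, ContDiffAt ℝ (n + 1 : ℕ) (fun z => fderiv ℝ h z (e i)) x := fun i =>
    contDiffAt_fderiv_apply (n := n + 1) hh _
  have h2 : ∀ i, ContDiffAt ℝ n (fun z => fderiv ℝ (fun z => fderiv ℝ h z (e i)) z (e i)) x :=
    fun i => contDiffAt_fderiv_apply (h1 i) _
  have hform : ∀ y : EucSpace d, dirDeriv (n + 2) y h x
      = ∑ i, ((inner ℝ y (e i) : ℝ) : ℂ) *
        iteratedFDeriv ℝ (n + 1) (fun z => fderiv ℝ h z (e i)) x fun _ => y := fun y => by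
    unfold dirDeriv
    rw [iteratedFDeriv_succ_apply_right]
    simp only [iteratedFDeriv_clm_apply_const hD]
    have hA : ∀ A : EucSpace d →L[ℝ] ℂ, A y = ∑ i, ((inner ℝ y (e i) : ℝ) : ℂ) * A (e i) := by
      intro A
      conv_lhs => rw [← e.sum_repr' y]
      rw [map_sum]
      refine Finset.sum_congr rfl fun i _ => ?_
      rw [map_smul, Complex.real_smul, real_inner_comm]
    exact hA _
  have hlap : ∀ y : EucSpace d, dirDeriv n y (Δ h) x
      = ∑ i, iteratedFDeriv ℝ n
        (fun z => fderiv ℝ (fun z => fderiv ℝ h z (e i)) z (e i)) x fun _ => y := fun y => by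
    unfold dirDeriv
    rw [((laplacian_eventuallyEq (hh.of_le (by norm_cast; omega))).iteratedFDeriv ℝ n).eq_of_nhds,
      iteratedFDeriv_fun_sum_apply fun i _ => h2 i, sum_apply]
  simp only [hform, hlap, Finset.sum_mul]
  rw [integral_finsetSum, integral_finsetSum, Finset.mul_sum]
  · refine Finset.sum_congr rfl fun i _ => ?_
    have := integral_inner_mul_form_mul_gaussWeight hd
      (iteratedFDeriv ℝ (n + 1) (fun z => fderiv ℝ h z (e i)) x) _ (n + 1 : ℝ) (e i)
      (fun y => fderiv_iteratedFDeriv_diag n (h1 i) (e i) y)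
    rw [this]
    push_cast; rfl
  · exact fun i _ => integrable_mul_gaussWeight hd
      (contDiff_multilinear_diag _ (n := 0)).continuous (norm_multilinear_diag_le _)
  · intro i _
    refine integrable_mul_gaussWeight hd (C := ‖e i‖ * ‖iteratedFDeriv ℝ (n + 1)
      (fun z => fderiv ℝ h z (e i)) x‖) (k := n + 1 + 1) ?_ fun y => ?_
    · exact (by fun_prop : Continuous fun y : EucSpace d => ((inner ℝ y (e i) : ℝ) : ℂ)).mul
        (contDiff_multilinear_diag _ (n := 0)).continuous
    · rw [norm_mul, Complex.norm_real]
      calc _ ≤ (‖y‖ * ‖e i‖) * (‖iteratedFDeriv ℝ (n + 1) (fun z => fderiv ℝ h z (e i)) x‖ *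
            ‖y‖ ^ (n + 1)) := by
            gcongr
            · exact norm_inner_le_norm y (e i)
            · exact norm_multilinear_diag_le _ y
        _ = _ := by ring

lemma pochhammer_succ (a : ℂ) (k : ℕ) : pochhammer a (k + 1) = pochhammer a k * (a + k) :=
  ascPochhammer_succ_eval k a

lemma integral_taylorForm_gauss (hd : 0 < d) (k : ℕ) : ∀ {h : EucSpace d → ℂ} {x : EucSpace d},
    ContDiffAt ℝ (2 * k : ℕ) h x →
    ∫ y, dirDeriv (2 * k) y h x * gaussWeight y
      = pochhammer (1 / 2) k * polyLaplacian k h x *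
        ∫ y : EucSpace d, (gaussWeight y : ℂ) := by
  induction k with
  | zero =>
    intro h x _
    simp [dirDeriv, pochhammer, polyLaplacian, integral_const_mul]
  | succ k ih =>
    intro h x hh
    rw [show 2 * (k + 1) = 2 * k + 2 by ring] at hh ⊢
    rw [integral_taylorForm_gauss_step hd hh, ih (contDiffAt_laplacian hh), pochhammer_succ]
    have : polyLaplacian (k + 1) h x = polyLaplacian k (Δ h) x := rfl
    rw [this]
    push_cast
    ring

lemma integral_form_mul_gaussWeight (hd : 0 < d) {m : ℕ}
    (T : ContinuousMultilinearMap ℝ (fun _ : Fin m => EucSpace d) ℂ) :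
    ∫ y, (T fun _ => y) * gaussWeight y
      = sphereIntegral T * (Complex.Gamma ((d + m : ℂ) / 2) / 2) := by
  have h := integral_multilinear_mul_radial T hd fun r => (Real.exp (-r ^ 2) : ℝ)
  have hg : ∫ r in Set.Ioi (0 : ℝ), (r : ℂ) ^ (d - 1 + m) * (Real.exp (-r ^ 2) : ℝ)
      = Complex.Gamma ((d + m : ℂ) / 2) / 2 := by
    have h1 := integral_rpow_mul_exp_neg_rpow (p := 2) (q := (d - 1 + m : ℕ)) two_pos
      (by linarith [Nat.cast_nonneg (α := ℝ) (d - 1 + m)])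
    have h2 : ∫ r in Set.Ioi (0 : ℝ), r ^ (d - 1 + m) * Real.exp (-r ^ 2)
        = 1 / 2 * Real.Gamma ((d + m : ℝ) / 2) := by
      rw [show (d + m : ℝ) = ((d - 1 + m : ℕ) : ℝ) + 1 by
        push_cast [Nat.cast_sub (Nat.succ_le_of_lt hd)]; ring, ← h1]
      refine setIntegral_congr_fun measurableSet_Ioi fun r hr => ?_
      simp only [Real.rpow_natCast, Real.rpow_two]
    rw [show ((d + m : ℂ) / 2) = ((d + m : ℝ) / 2 : ℝ) by push_cast; rfl, Complex.Gamma_ofReal]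
    have h3 := congrArg (fun r : ℝ => (r : ℂ)) h2
    simp only [← integral_complex_ofReal] at h3
    push_cast at h3 ⊢
    rw [h3]
    ring
  rw [hg] at h
  exact h

lemma Gamma_add_natCast {a : ℝ} (ha : 0 < a) (k : ℕ) :
    Complex.Gamma (a + k) = pochhammer a k * Complex.Gamma a := by
  induction k with
  | zero => simp [pochhammer]
  | succ k ih =>
    have hne : (a + k : ℂ) ≠ 0 := by
      have : (a + k : ℝ) ≠ 0 := by positivity
      exact_mod_cast this
    rw [pochhammer_succ, Nat.cast_succ, ← add_assoc, Complex.Gamma_add_one _ hne, ih]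
    ring

/-- The spherical mean of an even Taylor form is a multiple of the iterated Laplacian. -/
lemma sphereIntegral_iteratedFDeriv (hd : 0 < d) (k : ℕ) {h : EucSpace d → ℂ} {x : EucSpace d}
    (hh : ContDiffAt ℝ (2 * k : ℕ) h x) :
    sphereIntegral (iteratedFDeriv ℝ (2 * k) h x)
      = unitSphereArea d * (pochhammer (1 / 2) k / pochhammer ((d : ℂ) / 2) k) *
        polyLaplacian k h x := by
  have hd2 : (0 : ℝ) < (d : ℝ) / 2 := by positivity
  have h1 := integral_form_mul_gaussWeight hd (iteratedFDeriv ℝ (2 * k) h x)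
  have h2 := integral_taylorForm_gauss hd k hh
  have h3 := integral_form_mul_gaussWeight hd
    (ContinuousMultilinearMap.constOfIsEmpty ℝ (fun _ : Fin 0 => EucSpace d) (1 : ℂ))
  -- The constant form of degree zero accounts for the normalisation `ω_d`.
  have hω : sphereIntegral
      (ContinuousMultilinearMap.constOfIsEmpty ℝ (fun _ : Fin 0 => EucSpace d) (1 : ℂ))
      = unitSphereArea d := by
    simp [sphereIntegral, unitSphereArea, Measure.real]
  simp only [ContinuousMultilinearMap.constOfIsEmpty_apply, one_mul] at h3
  rw [hω] at h3
  have hΓ := Gamma_add_natCast hd2 k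
  have ha : ((d : ℝ) / 2 : ℝ) = ((d : ℂ) / 2) := by push_cast; rfl
  rw [ha] at hΓ
  have hG0 : Complex.Gamma ((d : ℂ) / 2) ≠ 0 := by
    rw [← ha]
    exact Complex.Gamma_ne_zero_of_re_pos (by rw [Complex.ofReal_re]; exact hd2)
  have hGk : Complex.Gamma ((d : ℂ) / 2 + k) ≠ 0 := by
    rw [← ha]
    refine Complex.Gamma_ne_zero_of_re_pos ?_
    rw [Complex.add_re, Complex.ofReal_re, Complex.natCast_re]
    positivity
  have hp : pochhammer ((d : ℂ) / 2) k ≠ 0 := fun h0 => hGk (by rw [hΓ, h0, zero_mul])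
  have e1 : ((d : ℂ) + (2 * k : ℕ)) / 2 = (d : ℂ) / 2 + k := by push_cast; ring
  have e2 : ((d : ℂ) + (0 : ℕ)) / 2 = (d : ℂ) / 2 := by simp
  unfold dirDeriv at h2
  rw [h1, e1, h3, e2, hΓ] at h2
  have h4 : sphereIntegral (iteratedFDeriv ℝ (2 * k) h x) * pochhammer ((d : ℂ) / 2) k
      = pochhammer (1 / 2) k * polyLaplacian k h x * unitSphereArea d := by
    refine mul_right_cancel₀ hG0 ?_
    linear_combination 2 * h2
  rw [eq_comm, mul_div_assoc', div_mul_eq_mul_div, div_eq_iff hp, h4]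
  ring

end Gaussian

/-! ### Comparison of the two operators -/

lemma compl_closedBall_inter_lattice {d : ℕ} (L : Submodule ℤ (EucSpace d)) {ε : ℝ} (hε : 0 < ε)
    (hεa : ε < latticeMinDist L) :
    (Metric.closedBall 0 ε)ᶜ ∩ (L : Set (EucSpace d))
      = (Set.univ ∩ (L : Set (EucSpace d))) \ {0} := by
  ext z
  simp only [Set.mem_inter_iff, Set.mem_compl_iff, Metric.mem_closedBall, dist_zero_right, not_le,
    SetLike.mem_coe, Set.mem_sdiff, Set.mem_univ, true_and, Set.mem_singleton_iff]
  constructor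
  · rintro ⟨h1, h2⟩
    exact ⟨h2, norm_pos_iff.1 (hε.trans h1)⟩
  · rintro ⟨h1, h2⟩
    refine ⟨hεa.trans_le (csInf_le ⟨0, ?_⟩ ⟨z, h1, h2, rfl⟩), h1⟩
    rintro r ⟨y, _, _, rfl⟩
    exact norm_nonneg y

/-- For `ε < a_Λ` the two coefficients contain the same lattice sum, so they differ only by the
contribution of the ball `|y| ≤ ε` to the Hadamard integral. -/
lemma hsemCoeff_eq {d : ℕ} (L : Submodule ℤ (EucSpace d)) {ε : ℝ} (hε : 0 < ε)
    (hεa : ε < latticeMinDist L) (χ : EucSpace d → ℝ) (ν : ℂ) (k : ℕ) (g : EucSpace d → ℂ)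
    (x : EucSpace d) (β : ℝ) :
    hsemCoeff L χ ν k g x β = localSEMCoeff L χ ν ε k g x β
      - (1 / (ZLattice.covolume L : ℂ)) *
        (hadamardIntegral Set.univ ν (fun z => smoothCutoff χ β z * dirDeriv (2 * k) z g x)
          - ∫ z in (Metric.closedBall 0 ε)ᶜ,
            smoothCutoff χ β z * (dirDeriv (2 * k) z g x / (‖z‖ : ℂ) ^ ν)) := by
  unfold hsemCoeff localSEMCoeff hadamardSumIntegral sumIntegral
  rw [compl_closedBall_inter_lattice L hε hεa]
  simp only [mul_div_assoc]
  ring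

lemma tendsto_hsemCoeff {d : ℕ} (hd : 0 < d) (L : Submodule ℤ (EucSpace d)) {ε : ℝ} (hε : 0 < ε)
    (hεa : ε < latticeMinDist L) {χ : EucSpace d → ℝ} (hχ : IsMollifier χ) {ν : ℂ}
    (hν : ∀ j : ℕ, ν ≠ d + j ∨ Odd j) (k : ℕ) (g : EucSpace d → ℂ) (x : EucSpace d) {c : ℂ}
    (hc : Tendsto (localSEMCoeff L χ ν ε k g x) (𝓝[>] 0) (𝓝 c)) :
    Tendsto (hsemCoeff L χ ν k g x) (𝓝[>] 0)
      (𝓝 (c - (1 / (ZLattice.covolume L : ℂ)) *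
        -exteriorMoment (iteratedFDeriv ℝ (2 * k) g x) ν ε)) := by
  obtain ⟨w, hw0, hw⟩ := hχ.exists_schwartzMap
  have hlim := tendsto_hadamardIntegral_sub (iteratedFDeriv ℝ (2 * k) g x) hd hν hε w hw0
  have hsub := hc.sub (hlim.const_mul (1 / (ZLattice.covolume L : ℂ)))
  have heq : hsemCoeff L χ ν k g x =ᶠ[𝓝[>] 0] fun β => localSEMCoeff L χ ν ε k g x β
      - (1 / (ZLattice.covolume L : ℂ)) *
        (hadamardIntegral Set.univ ν (fun z => w (β • z) * iteratedFDeriv ℝ (2 * k) g x fun _ => z)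
          - ∫ z in (Metric.closedBall 0 ε)ᶜ,
            w (β • z) * homogeneousKernel (iteratedFDeriv ℝ (2 * k) g x) ν z) := by
    filter_upwards [self_mem_nhdsWithin] with β hβ
    have hcut : smoothCutoff χ β = fun z => w (β • z) := funext (hw β hβ)
    rw [hsemCoeff_eq L hε hεa, hcut]
    simp only [dirDeriv, homogeneousKernel]
  exact Tendsto.congr' heq.symm hsub

theorem mainTheorem12 {d : ℕ} (hd : 0 < d)
    (L : Submodule ℤ (EucSpace d)) [DiscreteTopology L] [IsZLattice ℝ L]
    (χ χ' : EucSpace d → ℝ) (hχ : IsMollifier χ) (hχ' : IsMollifier χ')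
    (ℓ : ℕ) (ν : ℂ) (hν : ∀ n : ℕ, ν ≠ (d : ℂ) + 2 * n)
    (ε : ℝ) (hε : 0 < ε) (hεa : ε < latticeMinDist L)
    (g : EucSpace d → ℂ) (x : EucSpace d) (hg : ContDiffAt ℝ ((2 * ℓ : ℕ) : ℕ∞) g x) :
    (∀ k ≤ ℓ,
      (∃ c : ℂ, Tendsto (localSEMCoeff L χ ν ε k g x) (𝓝[>] 0) (𝓝 c)) ∧
      (∃ c : ℂ, Tendsto (hsemCoeff L χ' ν k g x) (𝓝[>] 0) (𝓝 c))) ∧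
    localSEMOperator L χ ν ε ℓ g x =
      hsemOperator L χ' ν ℓ g x
        - ((unitSphereArea d : ℂ) / (ZLattice.covolume L : ℂ)) *
          ∑ k ∈ Finset.range (ℓ + 1),
            pochhammer (1 / 2) k / (((2 * k).factorial : ℂ) * pochhammer ((d : ℂ) / 2) k) *
              ((ε : ℂ) ^ (-ν + (2 * k + d)) / (ν - (2 * k + d))) *
              polyLaplacian k g x := by
  have hν' : ∀ j : ℕ, ν ≠ d + j ∨ Odd j := fun j => by
    rcases Nat.even_or_odd' j with ⟨n, rfl | rfl⟩
    · exact .inl (by simpa using hν n)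
    · exact .inr (odd_two_mul_add_one n)
  choose c hc using fun k => exists_localSEMCoeff_limit L ν hε k g x
  have hH := fun k => tendsto_hsemCoeff hd L hε hεa hχ' hν' k g x (hc k χ' hχ')
  refine ⟨fun k _ => ⟨⟨_, hc k χ hχ⟩, ⟨_, hH k⟩⟩, ?_⟩
  unfold localSEMOperator hsemOperator
  rw [Finset.mul_sum, ← Finset.sum_sub_distrib]
  refine Finset.sum_congr rfl fun k hk => ?_
  have hk : k ≤ ℓ := Nat.lt_succ_iff.1 (Finset.mem_range.1 hk)
  rw [(hc k χ hχ).limUnder_eq, (hH k).limUnder_eq]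
  have hgk : ContDiffAt ℝ (2 * k : ℕ) g x :=
    hg.of_le (by
    have h : 2 * k ≤ 2 * ℓ := Nat.mul_le_mul_left 2 hk
    exact WithTop.coe_le_coe.2 (Nat.cast_le.2 h))
  have hexp : (d : ℂ) + (2 * k : ℕ) - ν = -ν + (2 * k + d) := by push_cast; ring
  have hden : ν - ((d : ℂ) + (2 * k : ℕ)) = ν - (2 * k + d) := by push_cast; ring
  unfold exteriorMoment
  rw [sphereIntegral_iteratedFDeriv hd k hgk, hexp, hden]
  ring
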